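/- Let $n,N$ be positive integers, let $\Omega\subset\mathbb{R}^n$ be a bounded Lipschitz domain (bounded, open, connected, and near each boundary point, in suitable orthonormal coordinates, the strict epigraph of a Lipschitz function), and let $1<p<\infty$. Equip $\mathbb{R}^{N\times n}$ with the Euclidean (Frobenius) norm $|\cdot|$ and inner product $\langle\cdot,\cdot\rangle$, let $Q=(0,1)^n$, and put $V(\xi)=(1+|\xi|^2)^{\frac{p/2-1}{2}}\xi$ for $\xi\in\mathbb{R}^{N\times n}$. Here $W^{1,\infty}_0(Q,\mathbb{R}^N)=W^{1,\infty}(Q,\mathbb{R}^N)\cap W^{1,1}_0(Q,\mathbb{R}^N)$, and $C_0^\infty(\Omega,\mathbb{R}^N)$ is the set of smooth maps with compact support in $\Omega$. Let $F:\overline{\Omega}\times\mathbb{R}^{N\times n}\to\mathbb{R}$ be such that $F(\cdot,z)$ is Lebesgue measurable on $\Omega$ for every $z$, and ($\overline{\mathrm{H}}0$) $F(x,\cdot)$ is of class $C^2$ for every $x\in\overline\Omega$, and $F_{zz}$ is continuous on $\overline\Omega\times\mathbb{R}^{N\times n}$; ($\overline{\mathrm{H}}1$) there is $c_1>0$ with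 $|F(x,z)|\le c_1(1+|z|^p)$ for all $(x,z)\in\overline\Omega\times\mathbb{R}^{N\times n}$; ($\overline{\mathrm{H}}2$) there is $c_2>0$ such that for all $(x_0,z)\in\Omega\times\mathbb{R}^{N\times n}$ and all $\varphi\in W^{1,\infty}_0(Q,\mathbb{R}^N)$, $$c_2\int_Q|V(\nabla\varphi)|^2\,dx\le\int_Q\bigl(F(x_0,z+\nabla\varphi)-F(x_0,z)\bigr)\,dx.$$ Assume moreover that $F(x_0,\cdot)$ is quasiconvex for every $x_0\in\overline\Omega$, that is, $F(x_0,z)\le\int_Q F(x_0,z+\nabla\varphi)\,dx$ for all $z\in\mathbb{R}^{N\times n}$ and all $\varphi\in W_0^{1,\infty}(Q,\mathbb{R}^N)$. Let $\overline u\in W^{1,\infty}(\Omega,\mathbb{R}^N)$ and $c_3>0$ be such that, for all $\varphi\in C_0^\infty(\Omega,\mathbb{R}^N)$, $$\int_\Omega\langle F_z(x,\nabla\overline u),\nabla\varphi\rangle\,dx=0\quad\text{and}\quad c_3\int_\Omega|\nabla\varphi|^2\,dx\le\int_\Omega F_{zz}(x,\nabla\overline u)[\nabla\varphi,\nabla\varphi]\,dx.$$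 Then there is $\delta>0$ such that $$\int_\Omega F(x,\nabla\overline u)\,dx\le\int_\Omega F(x,\nabla\overline u+\nabla\varphi)\,dx$$ for every $\varphi\in C_0^\infty(\Omega,\mathbb{R}^N)$ with $[\nabla\varphi]_{\mathrm{BMO}(\Omega)}\le\delta$, where $$[f]_{\mathrm{BMO}(\Omega)}=\sup_{B(x,r)\subseteq\Omega}\frac{1}{|B(x,r)|}\int_{B(x,r)}\Bigl|f(y)-\frac{1}{|B(x,r)|}\int_{B(x,r)}f\Bigr|\,dy.$$ -/

import Mathlib

open MeasureTheory Metric Set Filter Topology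
open scoped ContDiff ENNReal

noncomputable section

/-- Euclidean space `ℝᵏ`. -/
abbrev Vec (k : ℕ) : Type := EuclideanSpace ℝ (Fin k)

/-- Real `N × n` matrices with the Euclidean (Frobenius) inner product and norm. -/
abbrev Mat (N n : ℕ) : Type := EuclideanSpace ℝ (Fin N × Fin n)

/-- The classical gradient `(∇φ)ᵢⱼ = ∂ⱼφᵢ`. -/
def grad {n N : ℕ} (φ : Vec n → Vec N) (x : Vec n) : Mat N n :=
  WithLp.toLp 2 fun ij => fderiv ℝ φ x (EuclideanSpace.single ij.2 1) ij.1

/-- `C_c^∞(Ω, E)`: smooth maps with compact support contained in `Ω`. -/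
structure IsTestMap {n : ℕ} {E : Type*} [NormedAddCommGroup E] [NormedSpace ℝ E]
    (Ω : Set (Vec n)) (φ : Vec n → E) : Prop where
  smooth : ContDiff ℝ ∞ φ
  compact : HasCompactSupport φ
  subset : tsupport φ ⊆ Ω

/-- A bounded Lipschitz domain: bounded, open, connected, and near each boundary point the
strict epigraph, in some direction `e`, of a Lipschitz function of the variables
orthogonal to `e`. -/
structure IsLipschitzDomain {n : ℕ} (Ω : Set (Vec n)) : Prop where
  isOpen : IsOpen Ω
  connected : IsConnected Ω
  bounded : Bornology.IsBounded Ω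
  graph : ∀ x₀ ∈ frontier Ω, ∃ (e : Vec n) (r : ℝ) (K : NNReal) (ψ : Vec n → ℝ),
    ‖e‖ = 1 ∧ 0 < r ∧ LipschitzWith K ψ ∧
      ∀ x ∈ ball x₀ r, (x ∈ Ω ↔ ψ (x - inner ℝ e x • e) < inner ℝ e x)

/-- `u ∈ W^{1,∞}(Ω, ℝᴺ)` with weak gradient `G`. -/
structure MemW1Inf {n N : ℕ} (Ω : Set (Vec n)) (u : Vec n → Vec N) (G : Vec n → Mat N n) :
    Prop where
  memLp : MemLp u ∞ (volume.restrict Ω)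
  memLp_grad : MemLp G ∞ (volume.restrict Ω)
  weak : ∀ η : Vec n → ℝ, IsTestMap Ω η → ∀ (i : Fin N) (j : Fin n),
    ∫ x in Ω, u x i * fderiv ℝ η x (EuclideanSpace.single j 1) = - ∫ x in Ω, G x (i, j) * η x

/-- `φ ∈ W₀^{1,∞}(Ω, ℝᴺ) = W^{1,∞} ∩ W₀^{1,1}` with weak gradient `G`, where `W₀^{1,1}` is the
closure of `C_c^∞` in `W^{1,1}`. -/
structure MemW1InfZero {n N : ℕ} (Ω : Set (Vec n)) (φ : Vec n → Vec N) (G : Vec n → Mat N n) :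
    Prop where
  memW1Inf : MemW1Inf Ω φ G
  approx : ∃ φs : ℕ → Vec n → Vec N, (∀ k, IsTestMap Ω (φs k)) ∧
    Tendsto (fun k => eLpNorm (fun x => φs k x - φ x) 1 (volume.restrict Ω)) atTop (𝓝 0) ∧
    Tendsto (fun k => eLpNorm (fun x => grad (φs k) x - G x) 1 (volume.restrict Ω)) atTop (𝓝 0)

/-- The open unit cube `(0,1)ⁿ`. -/
def unitCube (n : ℕ) : Set (Vec n) := {x | ∀ i, x i ∈ Ioo (0 : ℝ) 1}

/-- `V_β(ξ) = (1 + |ξ|²)^{(β-1)/2} ξ`. -/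
def auxV {N n : ℕ} (β : ℝ) (ξ : Mat N n) : Mat N n := (1 + ‖ξ‖ ^ 2) ^ ((β - 1) / 2) • ξ

/-- Morrey quasiconvexity (the cube has volume `1`). -/
def IsQuasiconvex {N n : ℕ} (f : Mat N n → ℝ) : Prop :=
  ∀ (z : Mat N n) (φ : Vec n → Vec N) (G : Vec n → Mat N n), MemW1InfZero (unitCube n) φ G →
    f z ≤ ∫ x in unitCube n, f (z + G x)

/-- The Hessian `F_zz(x, z)` of `F(x, ·)`, as a bilinear form. -/
def hessZ {N n : ℕ} (F : Vec n → Mat N n → ℝ) (x : Vec n) (z : Mat N n) :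
    Mat N n →L[ℝ] Mat N n →L[ℝ] ℝ :=
  fderiv ℝ (fderiv ℝ (F x)) z

/-- Regularity of the integrand: `F(x, ·)` is `C²` and `F_zz` is jointly continuous on
`closure Ω × ℝ^{N×n}`; and `F(·, z)` is Lebesgue measurable, so that the functional makes sense. -/
structure HypReg {N n : ℕ} (Ω : Set (Vec n)) (F : Vec n → Mat N n → ℝ) : Prop where
  contDiff : ∀ x ∈ closure Ω, ContDiff ℝ 2 (F x)
  continuous_hess :
    ContinuousOn (fun q : Vec n × Mat N n => hessZ F q.1 q.2) (closure Ω ×ˢ univ)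
  measurable : ∀ z, AEStronglyMeasurable (fun x => F x z) (volume.restrict Ω)

/-- `p`-growth. -/
def HypGrowth {N n : ℕ} (Ω : Set (Vec n)) (p : ℝ) (F : Vec n → Mat N n → ℝ) : Prop :=
  ∃ c₁ : ℝ, 0 < c₁ ∧ ∀ x ∈ closure Ω, ∀ z, |F x z| ≤ c₁ * (1 + ‖z‖ ^ p)

/-- Strong `p`-quasiconvexity. -/
def HypStrongQC {N n : ℕ} (Ω : Set (Vec n)) (p : ℝ) (F : Vec n → Mat N n → ℝ) : Prop :=
  ∃ c₂ : ℝ, 0 < c₂ ∧ ∀ x₀ ∈ Ω, ∀ (z : Mat N n) (φ : Vec n → Vec N) (G : Vec n → Mat N n),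
    MemW1InfZero (unitCube n) φ G →
      c₂ * ∫ x in unitCube n, ‖auxV (p / 2) (G x)‖ ^ 2 ≤
        ∫ x in unitCube n, (F x₀ (z + G x) - F x₀ z)

/-- The seminorm `[f]_{BMO(Ω)}`: the supremum of the mean oscillations of `f` over all balls
contained in `Ω`. -/
def bmoSeminorm {n : ℕ} {E : Type*} [NormedAddCommGroup E] [NormedSpace ℝ E]
    (Ω : Set (Vec n)) (f : Vec n → E) : ℝ≥0∞ :=
  ⨆ (x : Vec n) (r : ℝ) (_ : 0 < r) (_ : ball x r ⊆ Ω),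
    ⨍⁻ y in ball x r, ‖f y - ⨍ w in ball x r, f w ∂volume‖ₑ ∂volume

end

/-
Write `R` for the second order Taylor remainder of `F(x, ·)` at the bounded field `∇u`. Uniform
continuity of `F_zz` on compact sets and the growth of `F` give `|R(ξ)| ≤ (c₃/4)|ξ|² + C|ξ|^q` for
a large power `q`, so by the second variation it is enough to show that `C ∫ |∇φ|^q` is at most
`(c₃/4) ∫ |∇φ|²` when `[∇φ]_BMO` is small.

For that, mean oscillations of a continuous `f` over `Ω ∩ B(x, r)` are bounded by its interior BMO
seminorm: pushing balls inwards along the graph direction, with radii shrinking geometrically,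
compares the average near the boundary with the average over an interior ball, at the cost of a
convergent sum. A good-λ inequality follows, in which the stopping balls of `|f|` at a given level
are selected by the Vitali covering lemma and the oscillation is controlled on each of them by
`[f]_BMO`. Integrated against powers of the level it bounds `∫ |f|^q` by `ε ∫ |f|²`; a field of mean
zero is needed so that the averages over balls of a fixed size are small to start with, and `∇φ`
has mean zero because `φ` has compact support.
-/

section MeanOscillation

variable {α E : Type*} [MeasurableSpace α] [NormedAddCommGroup E] {μ : Measure α} {f : α → E}

lemma lintegral_enorm_sub_le_add (f : α → E) (c c' : E) :
    ∫⁻ y, ‖f y - c'‖ₑ ∂μ ≤ ∫⁻ y, ‖f y - c‖ₑ ∂μ + ‖c - c'‖ₑ * μ univ := by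
  rw [← lintegral_const, ← lintegral_add_right _ measurable_const]
  refine lintegral_mono fun y => ?_
  simpa only [edist_eq_enorm_sub] using edist_triangle (f y) c c'

lemma enorm_sub_mul_measure_univ_le (f : α → E) (c c' : E) :
    ‖c - c'‖ₑ * μ univ ≤ ∫⁻ y, (‖c - f y‖ₑ + ‖c' - f y‖ₑ) ∂μ := by
  rw [← lintegral_const]
  refine lintegral_mono fun y => ?_
  simpa only [edist_eq_enorm_sub, enorm_sub_rev (f y) c'] using edist_triangle c (f y) c'

lemma lintegral_enorm_sub_average_le [NormedSpace ℝ E] [CompleteSpace E] [IsFiniteMeasure μ]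
    (hf : Integrable f μ) (c : E) :
    ∫⁻ y, ‖f y - ⨍ z, f z ∂μ‖ₑ ∂μ ≤ 2 * ∫⁻ y, ‖f y - c‖ₑ ∂μ := by
  have hdiff : μ.real univ • (c - ⨍ z, f z ∂μ) = ∫ y, (c - f y) ∂μ := by
    rw [smul_sub, measure_smul_average, integral_sub (integrable_const c) hf, integral_const]
  have hmean : ‖c - ⨍ z, f z ∂μ‖ₑ * μ univ ≤ ∫⁻ y, ‖f y - c‖ₑ ∂μ := by
    calc ‖c - ⨍ z, f z ∂μ‖ₑ * μ univ = ‖μ.real univ • (c - ⨍ z, f z ∂μ)‖ₑ := by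
          rw [enorm_smul, Real.enorm_of_nonneg measureReal_nonneg, ofReal_measureReal, mul_comm]
      _ ≤ ∫⁻ y, ‖c - f y‖ₑ ∂μ := hdiff ▸ enorm_integral_le_lintegral_enorm _
      _ = ∫⁻ y, ‖f y - c‖ₑ ∂μ := by simp only [enorm_sub_rev]
  calc _ ≤ _ := lintegral_enorm_sub_le_add f c _
    _ ≤ _ := add_le_add_right hmean _
    _ = _ := (two_mul _).symm

end MeanOscillation

section Balls

lemma setLIntegral_setLIntegral_ball_le {X : Type*} [PseudoMetricSpace X]
    [SecondCountableTopology X] [MeasurableSpace X] [OpensMeasurableSpace X] {μ : Measure X}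
    [SFinite μ] {g : X → X → ℝ≥0∞} (hg : Measurable (Function.uncurry g)) {L : Set X}
    (hL : MeasurableSet L) (s : ℝ) :
    ∫⁻ y in L, ∫⁻ w in ball y s, g y w ∂μ ∂μ
      ≤ ∫⁻ w in thickening s L, ∫⁻ y in ball w s, g y w ∂μ ∂μ := by
  set T : Set (X × X) := {q | dist q.1 q.2 < s}
  have hT : MeasurableSet T := measurableSet_lt measurable_dist measurable_const
  have hball (y w : X) :
      (ball y s).indicator (g y) w = T.indicator (Function.uncurry g) (y, w) := by
    by_cases h : dist y w < s <;> simp [indicator, T, h, dist_comm w y]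
  calc ∫⁻ y in L, ∫⁻ w in ball y s, g y w ∂μ ∂μ
      = ∫⁻ y in L, ∫⁻ w, T.indicator (Function.uncurry g) (y, w) ∂μ ∂μ := by
        simp only [← hball, lintegral_indicator measurableSet_ball]
    _ = ∫⁻ w, ∫⁻ y in L, T.indicator (Function.uncurry g) (y, w) ∂μ ∂μ :=
        lintegral_lintegral_swap (hg.indicator hT).aemeasurable
    _ ≤ ∫⁻ w in thickening s L, ∫⁻ y in ball w s, g y w ∂μ ∂μ := by
        rw [← lintegral_indicator isOpen_thickening.measurableSet]
        refine lintegral_mono fun w => ?_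
        by_cases hw : w ∈ thickening s L
        · rw [indicator_of_mem hw, ← lintegral_indicator measurableSet_ball]
          refine (setLIntegral_le_lintegral _ _).trans (lintegral_mono fun y => ?_)
          by_cases h : dist y w < s <;> simp [indicator, T, h]
        · rw [indicator_of_notMem hw]
          refine ((setLIntegral_congr_fun hL fun y hy => ?_).trans lintegral_zero).le
          exact indicator_of_notMem (s := T)
            (fun h => hw (mem_thickening_iff.2 ⟨y, hy, (dist_comm _ _).trans_lt h⟩)) _

end Balls

section BallAverages

variable {n : ℕ} {E : Type*} [NormedAddCommGroup E] [NormedSpace ℝ E] {Ω : Set (Vec n)}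
  {f : Vec n → E}

lemma volume_ball_mul (x y : Vec n) {r k : ℝ} (hk : 0 < k) :
    volume (ball x (k * r)) = ENNReal.ofReal k ^ n * volume (ball y r) := by
  rw [Measure.addHaar_ball_center, Measure.addHaar_ball_mul_of_pos volume 0 hk,
    Measure.addHaar_ball_center volume y]
  simp [ENNReal.ofReal_pow hk.le]

lemma lintegral_sub_average_le_bmoSeminorm (f : Vec n → E) {x : Vec n} {r : ℝ} (hr : 0 < r)
    (hB : ball x r ⊆ Ω) :
    ∫⁻ y in ball x r, ‖f y - ⨍ w in ball x r, f w‖ₑ ≤ bmoSeminorm Ω f * volume (ball x r) := by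
  have hle : ⨍⁻ y in ball x r, ‖f y - ⨍ w in ball x r, f w‖ₑ ∂volume ≤ bmoSeminorm Ω f :=
    le_iSup_of_le x (le_iSup_of_le r (le_iSup_of_le hr (le_iSup_of_le hB le_rfl)))
  rwa [setLAverage_eq,
    ENNReal.div_le_iff (measure_ball_pos volume x hr).ne' measure_ball_lt_top.ne] at hle

lemma stronglyMeasurable_average_ball (hf : Continuous f) (s : ℝ) :
    StronglyMeasurable (fun w : Vec n => ⨍ z in ball w s, f z) := by
  have htranslate (w : Vec n) : ⨍ z in ball w s, f z
      = (volume.real (ball (0 : Vec n) s))⁻¹ • ∫ v in ball (0 : Vec n) s, f (w + v) := by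
    rw [setAverage_eq, Measure.real, Measure.addHaar_ball_center, ← Measure.real,
      ← (measurePreserving_add_left volume w).setIntegral_preimage_emb
        (MeasurableEquiv.addLeft w).measurableEmbedding f (ball w s), preimage_add_ball, sub_self]
  simp_rw [htranslate]
  have hadd : StronglyMeasurable (fun q : Vec n × Vec n => f (q.1 + q.2)) :=
    (hf.comp continuous_add).stronglyMeasurable
  exact hadd.integral_prod_right.const_smul _

lemma setLIntegral_comp_add_right_ball_le (g : Vec n → ℝ≥0∞) (w : Vec n) {v : Vec n} {s : ℝ}
    (hv : ‖v‖ ≤ s) : ∫⁻ y in ball w s, g (y + v) ≤ ∫⁻ y in ball w (2 * s), g y := by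
  have hsub : ball w s ⊆ (· + v) ⁻¹' ball w (2 * s) := fun y hy => by
    rw [mem_preimage, mem_ball_iff_norm, add_sub_right_comm]
    linarith [norm_add_le (y - w) v, mem_ball_iff_norm.1 hy]
  rw [← (measurePreserving_add_right volume v).setLIntegral_comp_preimage_emb
    (MeasurableEquiv.addRight v).measurableEmbedding g]
  exact lintegral_mono_set hsub

lemma setLIntegral_enorm_sub_add_enorm_shift_sub_le {w v : Vec n} {s : ℝ} (hf : Continuous f)
    (hs : 0 < s) (hv : ‖v‖ ≤ s) (hw : ball w (2 * s) ⊆ Ω) :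
    ∫⁻ y in ball w s, (‖f y - ⨍ z in ball w (2 * s), f z‖ₑ
        + ‖f (y + v) - ⨍ z in ball w (2 * s), f z‖ₑ)
      ≤ 2 ^ (n + 1) * bmoSeminorm Ω f * volume (ball (0 : Vec n) s) := by
  set c := ⨍ z in ball w (2 * s), f z
  have hmeas : Measurable fun y => ‖f y - c‖ₑ := (hf.sub continuous_const).enorm.measurable
  have hosc := lintegral_sub_average_le_bmoSeminorm f (by positivity) hw
  rw [lintegral_add_left hmeas]
  calc _ ≤ (∫⁻ y in ball w (2 * s), ‖f y - c‖ₑ) + ∫⁻ y in ball w (2 * s), ‖f y - c‖ₑ :=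
        add_le_add (lintegral_mono_set (ball_subset_ball (by linarith)))
          (setLIntegral_comp_add_right_ball_le (fun y => ‖f y - c‖ₑ) w hv)
    _ ≤ 2 * (bmoSeminorm Ω f * volume (ball w (2 * s))) := by
        rw [← two_mul]
        gcongr
    _ = _ := by
        rw [volume_ball_mul w 0 two_pos, ENNReal.ofReal_ofNat]
        ring

lemma setLIntegral_enorm_sub_shift_le {L : Set (Vec n)} {v : Vec n} {s : ℝ} (hf : Continuous f)
    (hL : MeasurableSet L) (hs : 0 < s) (hv : ‖v‖ ≤ s)
    (hΩ : ∀ w ∈ thickening s L, ball w (2 * s) ⊆ Ω) :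
    ∫⁻ y in L, ‖f y - f (y + v)‖ₑ ≤ 2 ^ (n + 1) * bmoSeminorm Ω f * volume (thickening s L) := by
  set c : Vec n → E := fun w => ⨍ z in ball w (2 * s), f z
  set V := volume (ball (0 : Vec n) s)
  have hc : StronglyMeasurable c := stronglyMeasurable_average_ball hf _
  have hmeas : Measurable (Function.uncurry fun y w => ‖f y - c w‖ₑ + ‖f (y + v) - c w‖ₑ) := by
    have hshift : StronglyMeasurable fun q : Vec n × Vec n => f (q.1 + v) :=
      (by fun_prop : Continuous _).stronglyMeasurable
    exact ((hf.comp continuous_fst).stronglyMeasurable.sub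
      (hc.comp_measurable measurable_snd)).enorm.add
        (hshift.sub (hc.comp_measurable measurable_snd)).enorm
  refine (ENNReal.mul_le_mul_iff_left (measure_ball_pos volume (0 : Vec n) hs).ne'
    measure_ball_lt_top.ne).1 ?_
  calc (∫⁻ y in L, ‖f y - f (y + v)‖ₑ) * V
      = ∫⁻ y in L, ‖f y - f (y + v)‖ₑ * V :=
        (lintegral_mul_const' _ _ measure_ball_lt_top.ne).symm
    _ ≤ ∫⁻ y in L, ∫⁻ w in ball y s, (‖f y - c w‖ₑ + ‖f (y + v) - c w‖ₑ) := by
        refine lintegral_mono fun y => ?_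
        rw [show V = volume.restrict (ball y s) univ by
          rw [Measure.restrict_apply_univ, Measure.addHaar_ball_center]]
        exact enorm_sub_mul_measure_univ_le c _ _
    _ ≤ ∫⁻ w in thickening s L, ∫⁻ y in ball w s, (‖f y - c w‖ₑ + ‖f (y + v) - c w‖ₑ) :=
        setLIntegral_setLIntegral_ball_le hmeas hL s
    _ ≤ ∫⁻ _ in thickening s L, 2 ^ (n + 1) * bmoSeminorm Ω f * V :=
        setLIntegral_mono' isOpen_thickening.measurableSet fun w hw =>
          setLIntegral_enorm_sub_add_enorm_shift_sub_le hf hs hv (hΩ w hw)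
    _ = 2 ^ (n + 1) * bmoSeminorm Ω f * volume (thickening s L) * V := by
        rw [setLIntegral_const]
        ring

end BallAverages

section Graph

variable {V : Type*} [NormedAddCommGroup V] [NormedSpace ℝ V]

/-- `h` measures the height above a Lipschitz graph in the unit direction `e`: for the graph of `ψ`
over the hyperplane orthogonal to `e`, it is `h y = ⟪e, y⟫ - ψ (y - ⟪e, y⟫ e)`. -/
structure IsGraphHeight (h : V → ℝ) (e : V) (Λ : ℝ) : Prop where
  norm_dir : ‖e‖ = 1
  abs_sub_le : ∀ y z, |h y - h z| ≤ Λ * ‖y - z‖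
  add_smul : ∀ y (t : ℝ), h (y + t • e) = h y + t

/-- The infinite cylinder of direction `e` over the ball `B(x, ρ)`. -/
def ballCylinder (e x : V) (ρ : ℝ) : Set V := {y | ∃ t : ℝ, y + t • e ∈ ball x ρ}

/-- The points of the cylinder of direction `e` over `B(x, ρ)` whose height lies in `(α, β]`. -/
def graphSlab (h : V → ℝ) (e x : V) (ρ α β : ℝ) : Set V := ballCylinder e x ρ ∩ h ⁻¹' Ioc α β

variable {h : V → ℝ} {e x : V} {Λ ρ α β : ℝ}

lemma isOpen_ballCylinder (e x : V) (ρ : ℝ) : IsOpen (ballCylinder e x ρ) := by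
  have hunion : ballCylinder e x ρ = ⋃ t : ℝ, (· + t • e) ⁻¹' ball x ρ := by
    ext y
    simp only [ballCylinder, mem_ofPred_eq, mem_iUnion, mem_preimage]
  rw [hunion]
  exact isOpen_iUnion fun t => isOpen_ball.preimage (continuous_add_const (t • e))

lemma mem_ballCylinder_of_mem_ball {y : V} (hy : y ∈ ball x ρ) : y ∈ ballCylinder e x ρ :=
  ⟨0, by simpa using hy⟩

lemma add_smul_mem_ballCylinder_iff {y : V} {τ : ℝ} :
    y + τ • e ∈ ballCylinder e x ρ ↔ y ∈ ballCylinder e x ρ := by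
  constructor
  · rintro ⟨t, ht⟩
    exact ⟨τ + t, by rwa [add_smul, ← add_assoc]⟩
  · rintro ⟨t, ht⟩
    exact ⟨t - τ, by rwa [show y + τ • e + (t - τ) • e = y + t • e by module]⟩

lemma thickening_ballCylinder_subset (e x : V) (ρ s : ℝ) :
    thickening s (ballCylinder e x ρ) ⊆ ballCylinder e x (ρ + s) := by
  intro w hw
  obtain ⟨y, ⟨t, ht⟩, hwy⟩ := mem_thickening_iff.1 hw
  refine ⟨t, ?_⟩
  rw [mem_ball_iff_norm] at ht ⊢
  rw [dist_eq_norm] at hwy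
  calc ‖w + t • e - x‖ = ‖(y + t • e - x) + (w - y)‖ := by congr 1; abel
    _ < ρ + s := (norm_add_le _ _).trans_lt (add_lt_add ht hwy)

lemma graphSlab_mono {ρ' α' β' : ℝ} (hρ : ρ ≤ ρ') (hα : α' ≤ α) (hβ : β ≤ β') :
    graphSlab h e x ρ α β ⊆ graphSlab h e x ρ' α' β' :=
  inter_subset_inter (fun _ ⟨t, ht⟩ => ⟨t, ball_subset_ball hρ ht⟩)
    (preimage_mono (Ioc_subset_Ioc hα hβ))

namespace IsGraphHeight

lemma one_le (H : IsGraphHeight h e Λ) : 1 ≤ Λ := by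
  have hle := H.abs_sub_le (0 + (1 : ℝ) • e) 0
  rw [H.add_smul] at hle
  simpa [H.norm_dir] using hle

lemma lipschitzWith (H : IsGraphHeight h e Λ) : LipschitzWith Λ.toNNReal h := by
  refine LipschitzWith.of_dist_le_mul fun y z => ?_
  rw [Real.dist_eq, dist_eq_norm, Real.coe_toNNReal _ (by linarith [H.one_le])]
  exact H.abs_sub_le y z

lemma abs_sub_le_mul (H : IsGraphHeight h e Λ) {y z : V} {s : ℝ} (hyz : ‖y - z‖ ≤ s) :
    |h y - h z| ≤ Λ * s :=
  (H.abs_sub_le y z).trans (mul_le_mul_of_nonneg_left hyz (by linarith [H.one_le]))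

lemma preimage_graphSlab (H : IsGraphHeight h e Λ) (x : V) (ρ α β τ : ℝ) :
    (· + τ • e) ⁻¹' graphSlab h e x ρ (α + τ) (β + τ) = graphSlab h e x ρ α β := by
  ext y
  simp only [graphSlab, mem_preimage, mem_inter_iff, add_smul_mem_ballCylinder_iff, H.add_smul,
    mem_Ioc, add_lt_add_iff_right, add_le_add_iff_right]

lemma norm_sub_lt_of_mem_graphSlab (H : IsGraphHeight h e Λ) {y : V}
    (hy : y ∈ graphSlab h e x ρ α β) (T : ℝ) :
    ‖y - (x + (T - h x) • e)‖ < ρ + Λ * ρ + |h y - T| := by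
  obtain ⟨⟨t, ht⟩, -⟩ := hy
  rw [mem_ball_iff_norm] at ht
  have hheight : |h y + t - h x| ≤ Λ * ρ := by simpa only [H.add_smul] using H.abs_sub_le_mul ht.le
  calc ‖y - (x + (T - h x) • e)‖
      = ‖(y + t • e - x) - ((h y + t - h x) - (h y - T)) • e‖ := by congr 1; module
    _ ≤ ‖y + t • e - x‖ + |(h y + t - h x) - (h y - T)| := by
        simpa only [norm_smul, H.norm_dir, mul_one, Real.norm_eq_abs] using
          norm_sub_le (y + t • e - x) (((h y + t - h x) - (h y - T)) • e)
    _ < ρ + Λ * ρ + |h y - T| := by linarith [abs_sub (h y + t - h x) (h y - T)]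

lemma thickening_graphSlab_subset (H : IsGraphHeight h e Λ) (x : V) (ρ α β s : ℝ) :
    thickening s (graphSlab h e x ρ α β)
      ⊆ graphSlab h e x (ρ + s) (α - Λ * s) (β + Λ * s) := by
  intro w hw
  refine ⟨thickening_ballCylinder_subset e x ρ s
    (thickening_subset_of_subset s inter_subset_left hw), ?_⟩
  obtain ⟨y, ⟨-, hyα, hyβ⟩, hwy⟩ := mem_thickening_iff.1 hw
  have hheight := abs_le.1 (H.abs_sub_le_mul (dist_eq_norm w y ▸ hwy).le)
  exact ⟨by linarith, by linarith⟩

variable [MeasurableSpace V] [BorelSpace V] {μ : Measure V}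

lemma measurableSet_graphSlab (H : IsGraphHeight h e Λ) (x : V) (ρ α β : ℝ) :
    MeasurableSet (graphSlab h e x ρ α β) :=
  (isOpen_ballCylinder e x ρ).measurableSet.inter
    (H.lipschitzWith.continuous.measurable measurableSet_Ioc)

lemma setLIntegral_graphSlab_add_add (H : IsGraphHeight h e Λ) (x : V) (ρ : ℝ) {a b c : ℝ}
    (hab : a ≤ b) (hbc : b ≤ c) (g : V → ℝ≥0∞) :
    (∫⁻ y in graphSlab h e x ρ a b, g y ∂μ) + ∫⁻ y in graphSlab h e x ρ b c, g y ∂μ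
      = ∫⁻ y in graphSlab h e x ρ a c, g y ∂μ := by
  have hdisj : Disjoint (graphSlab h e x ρ a b) (graphSlab h e x ρ b c) :=
    ((Ioc_disjoint_Ioc_of_le le_rfl).preimage h).mono inter_subset_right inter_subset_right
  rw [← lintegral_union (H.measurableSet_graphSlab x ρ b c) hdisj]
  simp only [graphSlab, ← inter_union_distrib_left, ← preimage_union,
    Ioc_union_Ioc_eq_Ioc hab hbc]

lemma setLIntegral_layer_eq_sum (H : IsGraphHeight h e Λ) (x : V) (ρ a : ℝ) {τ : ℝ} (hτ : 0 ≤ τ)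
    (g : V → ℝ≥0∞) (j : ℕ) :
    ∫⁻ y in graphSlab h e x ρ a (a + j * τ), g y ∂μ
      = ∑ i ∈ Finset.range j,
          ∫⁻ y in graphSlab h e x ρ (a + i * τ) (a + (i + 1 : ℕ) * τ), g y ∂μ := by
  induction j with
  | zero => simp [graphSlab]
  | succ j ih =>
    rw [Finset.sum_range_succ, ← ih, H.setLIntegral_graphSlab_add_add x ρ]
    · linarith [mul_nonneg j.cast_nonneg hτ]
    · push_cast
      linarith

variable [μ.IsAddRightInvariant]

lemma setLIntegral_graphSlab_shift (H : IsGraphHeight h e Λ) (x : V) (ρ α β τ : ℝ)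
    (g : V → ℝ≥0∞) :
    ∫⁻ y in graphSlab h e x ρ α β, g (y + τ • e) ∂μ
      = ∫⁻ y in graphSlab h e x ρ (α + τ) (β + τ), g y ∂μ := by
  rw [← H.preimage_graphSlab x ρ α β τ]
  exact (measurePreserving_add_right μ (τ • e)).setLIntegral_comp_preimage_emb
    (MeasurableEquiv.addRight (τ • e)).measurableEmbedding g _

lemma measure_graphSlab_two_mul (H : IsGraphHeight h e Λ) (x : V) (ρ : ℝ) {a : ℝ} (ha : 0 ≤ a) :
    μ (graphSlab h e x ρ 0 (2 * a)) = 2 * μ (graphSlab h e x ρ 0 a) := by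
  have hsplit := H.setLIntegral_graphSlab_add_add (μ := μ) x ρ ha (by linarith : a ≤ 2 * a) 1
  have hshift := H.setLIntegral_graphSlab_shift (μ := μ) x ρ 0 a a 1
  simp only [Pi.one_apply, setLIntegral_one, zero_add, ← two_mul] at hsplit hshift
  rw [← hsplit, ← hshift, two_mul]

variable {E : Type*} [NormedAddCommGroup E] {f : V → E}

lemma setLIntegral_graphSlab_le_shift (H : IsGraphHeight h e Λ) (hf : Continuous f) (c : E)
    (x : V) (ρ α β τ : ℝ) :
    ∫⁻ y in graphSlab h e x ρ α β, ‖f y - c‖ₑ ∂μ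
      ≤ ∫⁻ y in graphSlab h e x ρ (α + τ) (β + τ), ‖f y - c‖ₑ ∂μ
        + ∫⁻ y in graphSlab h e x ρ α β, ‖f y - f (y + τ • e)‖ₑ ∂μ := by
  have hmeas : Measurable fun y => ‖f (y + τ • e) - c‖ₑ :=
    (by fun_prop : Continuous fun y => f (y + τ • e) - c).enorm.measurable
  rw [← H.setLIntegral_graphSlab_shift x ρ α β τ (fun y => ‖f y - c‖ₑ), ← lintegral_add_left hmeas]
  refine lintegral_mono fun y => ?_
  rw [add_comm]
  simpa only [edist_eq_enorm_sub] using edist_triangle (f y) (f (y + τ • e)) c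

variable {a b τ : ℝ} {X : ℝ≥0∞}

lemma setLIntegral_graphSlab_le_shift_nsmul (H : IsGraphHeight h e Λ) (hf : Continuous f) (c : E)
    (hτ : 0 ≤ τ)
    (hX : ∀ α β, a ≤ α → β ≤ b → ∫⁻ y in graphSlab h e x ρ α β, ‖f y - f (y + τ • e)‖ₑ ∂μ ≤ X)
    (hα : a ≤ α) (i : ℕ) (hβ : β + i * τ ≤ b) :
    ∫⁻ y in graphSlab h e x ρ α β, ‖f y - c‖ₑ ∂μ
      ≤ ∫⁻ y in graphSlab h e x ρ (α + i * τ) (β + i * τ), ‖f y - c‖ₑ ∂μ + i * X := by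
  induction i with
  | zero => simp
  | succ i ih =>
    have hiτ : 0 ≤ i * τ := by positivity
    push_cast at hβ ⊢
    calc _ ≤ ∫⁻ y in graphSlab h e x ρ (α + i * τ) (β + i * τ), ‖f y - c‖ₑ ∂μ + i * X :=
          ih (by linarith)
      _ ≤ (∫⁻ y in graphSlab h e x ρ (α + i * τ + τ) (β + i * τ + τ), ‖f y - c‖ₑ ∂μ + X)
            + i * X := by
          gcongr
          exact (H.setLIntegral_graphSlab_le_shift hf c x ρ _ _ τ).trans
            (add_le_add_right (hX _ _ (by linarith) (by linarith)) _)
      _ = _ := by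
          rw [add_assoc, ← one_add_mul, add_comm (1 : ℝ≥0∞)]
          simp only [add_one_mul, add_assoc]

lemma two_mul_setLIntegral_layer_le (H : IsGraphHeight h e Λ) (hf : Continuous f) (c : E)
    (ha : 0 ≤ a) (hτ : 0 ≤ τ) {m : ℕ} (hm : m * τ = a)
    (hX : ∀ α β, a ≤ α → β ≤ 4 * a →
      ∫⁻ y in graphSlab h e x ρ α β, ‖f y - f (y + τ • e)‖ₑ ∂μ ≤ X) :
    2 * ∫⁻ y in graphSlab h e x ρ a (2 * a), ‖f y - c‖ₑ ∂μ
      ≤ ∫⁻ y in graphSlab h e x ρ (2 * a) (4 * a), ‖f y - c‖ₑ ∂μ + 3 * m * X := by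
  have hm2 : ((2 * m : ℕ) : ℝ) * τ = 2 * a := by
    rw [← hm]
    push_cast
    ring
  have honce := H.setLIntegral_graphSlab_le_shift_nsmul (β := 2 * a) hf c hτ hX le_rfl m
    (by linarith)
  have htwice := H.setLIntegral_graphSlab_le_shift_nsmul (β := 2 * a) hf c hτ hX le_rfl (2 * m)
    (by linarith)
  rw [hm, ← two_mul, show 2 * a + a = 3 * a by ring] at honce
  rw [hm2, show a + 2 * a = 3 * a by ring, show 2 * a + 2 * a = 4 * a by ring] at htwice
  rw [two_mul, ← H.setLIntegral_graphSlab_add_add x ρ (by linarith : 2 * a ≤ 3 * a)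
    (by linarith : 3 * a ≤ 4 * a)]
  refine (add_le_add honce htwice).trans_eq ?_
  push_cast
  ring

lemma setLIntegral_layer_le (H : IsGraphHeight h e Λ) (hf : Continuous f) (c : E)
    (hτ : 0 ≤ τ) (hτa : τ ≤ 2 * a) {m : ℕ} (hm : m * τ = a)
    (hX : ∀ α β, a ≤ α → β ≤ 4 * a →
      ∫⁻ y in graphSlab h e x ρ α β, ‖f y - f (y + τ • e)‖ₑ ∂μ ≤ X) :
    ∫⁻ y in graphSlab h e x ρ a (2 * a), ‖f y - c‖ₑ ∂μ
      ≤ m * (∫⁻ y in graphSlab h e x ρ (2 * a) (2 * a + τ), ‖f y - c‖ₑ ∂μ + m * X) := by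
  have hslice (i : ℕ) (hi : i ∈ Finset.range m) :
      ∫⁻ y in graphSlab h e x ρ (a + i * τ) (a + (i + 1 : ℕ) * τ), ‖f y - c‖ₑ ∂μ
        ≤ ∫⁻ y in graphSlab h e x ρ (2 * a) (2 * a + τ), ‖f y - c‖ₑ ∂μ + m * X := by
    have hmi : ((m - i : ℕ) : ℝ) * τ = a - i * τ := by
      rw [Nat.cast_sub (Finset.mem_range.1 hi).le, sub_mul, hm]
    have hlow : a + i * τ + (m - i : ℕ) * τ = 2 * a := by rw [hmi]; ring
    have hup : a + (i + 1 : ℕ) * τ + (m - i : ℕ) * τ = 2 * a + τ := by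
      rw [hmi]
      push_cast
      ring
    have hshift := H.setLIntegral_graphSlab_le_shift_nsmul (α := a + i * τ)
      (β := a + (i + 1 : ℕ) * τ) hf c hτ hX (by linarith [mul_nonneg i.cast_nonneg hτ]) (m - i)
      (by linarith)
    rw [hlow, hup] at hshift
    refine hshift.trans (by gcongr; omega)
  have hsum := H.setLIntegral_layer_eq_sum (μ := μ) x ρ a hτ (fun y => ‖f y - c‖ₑ) m
  rw [hm, ← two_mul] at hsum
  rw [hsum]
  refine (Finset.sum_le_card_nsmul _ _ _ hslice).trans_eq ?_
  rw [Finset.card_range, nsmul_eq_mul]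

end IsGraphHeight

end Graph

section DyadicLayers

lemma sum_range_add_le_of_two_mul_succ_le {J W : ℕ → ℝ≥0∞} {K : ℝ≥0∞}
    (hJ : ∀ k, 2 * J (k + 1) ≤ J k + K * W k) (N : ℕ) :
    ∑ k ∈ Finset.range (N + 1), J k + J N ≤ 2 * J 0 + K * ∑ k ∈ Finset.range N, W k := by
  induction N with
  | zero => simp [two_mul]
  | succ N ih =>
    calc ∑ k ∈ Finset.range (N + 2), J k + J (N + 1)
        = ∑ k ∈ Finset.range (N + 1), J k + 2 * J (N + 1) := by
          rw [Finset.sum_range_succ, add_assoc, ← two_mul]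
      _ ≤ ∑ k ∈ Finset.range (N + 1), J k + J N + K * W N := by
          rw [add_assoc]
          exact add_le_add_right (hJ N) _
      _ ≤ 2 * J 0 + K * ∑ k ∈ Finset.range (N + 1), W k := by
          rw [Finset.sum_range_succ W N, mul_add, ← add_assoc]
          exact add_le_add_left ih _

lemma sum_range_le_two_mul_of_eq_two_mul_succ {W : ℕ → ℝ≥0∞} (hW : ∀ k, W k = 2 * W (k + 1))
    (N : ℕ) : ∑ k ∈ Finset.range N, W k ≤ 2 * W 0 := by
  have htelescope : ∑ k ∈ Finset.range N, W k + 2 * W N = 2 * W 0 := by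
    induction N with
    | zero => simp
    | succ N ih => rw [Finset.sum_range_succ, ← hW, ← ih, two_mul, add_assoc]
  exact le_self_add.trans htelescope.le

lemma tsum_le_of_two_mul_succ_le {J W : ℕ → ℝ≥0∞} {K : ℝ≥0∞} (hW : ∀ k, W k = 2 * W (k + 1))
    (hJ : ∀ k, 2 * J (k + 1) ≤ J k + K * W k) : ∑' k, J k ≤ 2 * J 0 + K * (2 * W 0) := by
  refine ENNReal.tsum_le_of_sum_range_le fun N => ?_
  calc ∑ k ∈ Finset.range N, J k ≤ ∑ k ∈ Finset.range (N + 1), J k + J N := by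
        rw [Finset.sum_range_succ, add_assoc]
        exact le_self_add
    _ ≤ _ := sum_range_add_le_of_two_mul_succ_le hJ N
    _ ≤ _ := by
        gcongr
        exact sum_range_le_two_mul_of_eq_two_mul_succ hW N

lemma Ioc_subset_iUnion_Ioc_div_two_pow {T : ℝ} (hT : 0 < T) :
    Ioc 0 T ⊆ ⋃ k : ℕ, Ioc (T / 2 ^ (k + 1)) (T / 2 ^ k) := by
  rintro t ⟨ht0, htT⟩
  obtain ⟨k, hlt, hle⟩ := exists_nat_pow_near_of_lt_one (div_pos ht0 hT)
    ((div_le_one hT).2 htT) (one_half_pos (α := ℝ)) one_half_lt_one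
  rw [lt_div_iff₀ hT, one_div, inv_pow] at hlt
  rw [div_le_iff₀ hT, one_div, inv_pow] at hle
  exact mem_iUnion.2 ⟨k, by rwa [div_eq_inv_mul], by rwa [div_eq_inv_mul]⟩

lemma setLIntegral_graphSlab_le_tsum {V : Type*} [NormedAddCommGroup V] [NormedSpace ℝ V]
    [MeasurableSpace V] (μ : Measure V) (h : V → ℝ) (e x : V) (ρ : ℝ) {T : ℝ} (hT : 0 < T)
    (g : V → ℝ≥0∞) :
    ∫⁻ y in graphSlab h e x ρ 0 T, g y ∂μ
      ≤ ∑' k : ℕ, ∫⁻ y in graphSlab h e x ρ (T / 2 ^ (k + 1)) (T / 2 ^ k), g y ∂μ := by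
  refine (lintegral_mono_set ?_).trans (lintegral_iUnion_le _ _)
  simp only [graphSlab, ← inter_iUnion, ← preimage_iUnion]
  exact inter_subset_inter_right _ (preimage_mono (Ioc_subset_iUnion_Ioc_div_two_pow hT))

end DyadicLayers

section NearGraph

variable {n : ℕ} {E : Type*} [NormedAddCommGroup E] [NormedSpace ℝ E] {h : Vec n → ℝ} {e : Vec n}
  {Λ : ℝ}

/-- The configuration at scale `ρ` around a point `x` near a Lipschitz graph: `Ω` contains the
points above the graph at distance less than `4 T` from `x`. Layers at height `a ≤ T` will be
compared by vertical shifts of length `a / m`, so the number `m` of shifts is taken large with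
respect to the Lipschitz constant. -/
structure IsNearGraph (Ω : Set (Vec n)) (h : Vec n → ℝ) (e : Vec n) (Λ : ℝ) (x : Vec n)
    (ρ T : ℝ) (m : ℕ) : Prop where
  height : IsGraphHeight h e Λ
  pos : 0 < ρ
  top_eq : T = 2 * Λ * (1 + Λ) * ρ
  lt_steps : 3 * Λ * (1 + Λ) < m
  base_nonneg : 0 ≤ h x
  base_le : h x ≤ Λ * ρ
  above : ∀ z, ‖z - x‖ < 4 * T → 0 < h z → z ∈ Ω

namespace IsNearGraph

variable {Ω : Set (Vec n)} {x : Vec n} {ρ T : ℝ} {m : ℕ} {f : Vec n → E}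

lemma mul_le_half_top (G : IsNearGraph Ω h e Λ x ρ T m) : ρ + Λ * ρ ≤ T / 2 := by
  have hle : 1 * ((1 + Λ) * ρ) ≤ Λ * ((1 + Λ) * ρ) := by
    have := G.pos
    have := G.height.one_le
    gcongr
  linarith [G.top_eq]

lemma top_pos (G : IsNearGraph Ω h e Λ x ρ T m) : 0 < T := by
  nlinarith [G.mul_le_half_top, G.height.one_le, G.pos]

lemma six_mul_le_steps (G : IsNearGraph Ω h e Λ x ρ T m) : 6 * Λ ≤ m := by
  nlinarith [G.lt_steps, G.height.one_le]

lemma steps_pos (G : IsNearGraph Ω h e Λ x ρ T m) : (0 : ℝ) < m := by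
  linarith [G.six_mul_le_steps, G.height.one_le]

lemma six_mul_mul_step_le (G : IsNearGraph Ω h e Λ x ρ T m) {a : ℝ} (ha : 0 ≤ a) :
    6 * (Λ * (a / m)) ≤ a := by
  have hm := G.steps_pos
  calc 6 * (Λ * (a / m)) = 6 * Λ * (a / m) := by ring
    _ ≤ m * (a / m) := by gcongr; exact G.six_mul_le_steps
    _ = a := by field_simp

lemma step_le_mul_step (G : IsNearGraph Ω h e Λ x ρ T m) {a : ℝ} (ha : 0 ≤ a) :
    a / m ≤ Λ * (a / m) :=
  le_mul_of_one_le_left (div_nonneg ha m.cast_nonneg) G.height.one_le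

lemma step_le (G : IsNearGraph Ω h e Λ x ρ T m) {a : ℝ} (haT : a ≤ T / 2) : a / m ≤ ρ / 3 := by
  rw [div_le_iff₀ G.steps_pos]
  nlinarith [G.lt_steps, G.top_eq, G.pos]

lemma abs_sub_base_le (G : IsNearGraph Ω h e Λ x ρ T m) {t s : ℝ} (ht : 0 ≤ t) (hts : t ≤ s)
    (hs : T / 2 ≤ s) : |t - h x| ≤ s := by
  rw [abs_le]
  constructor <;> linarith [G.base_nonneg, G.base_le, G.mul_le_half_top, G.pos]

lemma graphSlab_subset_ball (G : IsNearGraph Ω h e Λ x ρ T m) {α β s : ℝ} (hα : 0 ≤ α)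
    (hβ : β ≤ s) (hs : T / 2 ≤ s) : graphSlab h e x (2 * ρ) α β ⊆ ball x (T + s) := by
  intro y hy
  have hnorm := G.height.norm_sub_lt_of_mem_graphSlab hy (h x)
  rw [sub_self, zero_smul, add_zero] at hnorm
  rw [mem_ball_iff_norm]
  linarith [G.mul_le_half_top, G.abs_sub_base_le (hα.trans hy.2.1.le) (hy.2.2.trans hβ) hs]

lemma ball_subset_of_mem_graphSlab (G : IsNearGraph Ω h e Λ x ρ T m) {a : ℝ} (ha : 0 < a)
    (haT : a ≤ T / 2) {w : Vec n} (hw : w ∈ graphSlab h e x (2 * ρ) (5 / 6 * a) (5 * a)) :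
    ball w (2 * (a / m)) ⊆ Ω := by
  intro z hz
  rw [mem_ball_iff_norm] at hz
  have hsmall := G.six_mul_mul_step_le ha.le
  have hstep := G.step_le_mul_step ha.le
  have hheight := abs_le.1 (G.height.abs_sub_le_mul hz.le)
  have hwx := G.graphSlab_subset_ball (s := 5 / 2 * T) (by linarith) (by linarith)
    (by linarith [G.top_pos]) hw
  rw [mem_ball_iff_norm] at hwx
  refine G.above z ?_ (by linarith [hw.2.1])
  linarith [norm_sub_le_norm_sub_add_norm_sub z w x, G.top_pos]

lemma setLIntegral_enorm_sub_shift_le (G : IsNearGraph Ω h e Λ x ρ T m) (hf : Continuous f)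
    {a α β : ℝ} (ha : 0 < a) (haT : a ≤ T / 2) (hα : a ≤ α) (hβ : β ≤ 4 * a) :
    ∫⁻ y in graphSlab h e x ρ α β, ‖f y - f (y + (a / m) • e)‖ₑ
      ≤ 2 ^ (n + 1) * bmoSeminorm Ω f * volume (graphSlab h e x (2 * ρ) 0 (8 * a)) := by
  have hτ : 0 < a / m := div_pos ha G.steps_pos
  have hsmall := G.six_mul_mul_step_le ha.le
  have hsub : thickening (a / m) (graphSlab h e x ρ α β)
      ⊆ graphSlab h e x (2 * ρ) (5 / 6 * a) (5 * a) :=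
    (G.height.thickening_graphSlab_subset x ρ α β (a / m)).trans
      (graphSlab_mono (by linarith [G.step_le haT, G.pos]) (by linarith) (by linarith))
  refine (_root_.setLIntegral_enorm_sub_shift_le (Ω := Ω) hf
    (G.height.measurableSet_graphSlab _ _ _ _) hτ ?_ fun w hw =>
      G.ball_subset_of_mem_graphSlab ha haT (hsub hw)).trans ?_
  · rw [norm_smul, G.height.norm_dir, mul_one, Real.norm_of_nonneg hτ.le]
  · gcongr
    exact hsub.trans (graphSlab_mono le_rfl (by linarith) (by linarith))

lemma setLIntegral_graphSlab_le (G : IsNearGraph Ω h e Λ x ρ T m) (hf : Continuous f) (c : E) :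
    ∫⁻ y in graphSlab h e x ρ 0 T, ‖f y - c‖ₑ
      ≤ 2 * (∫⁻ y in graphSlab h e x ρ (T / 2) T, ‖f y - c‖ₑ)
        + 3 * m * (2 ^ (n + 1) * bmoSeminorm Ω f) *
          (2 * volume (graphSlab h e x (2 * ρ) 0 (2 * T))) := by
  have hT := G.top_pos
  set W : ℕ → ℝ≥0∞ := fun k => volume (graphSlab h e x (2 * ρ) 0 (2 * T / 2 ^ k))
  have hW (k : ℕ) : W k = 2 * W (k + 1) := by
    simp only [W]
    rw [← G.height.measure_graphSlab_two_mul _ _ (by positivity), pow_succ]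
    congr 2
    field_simp
  have hlayer (k : ℕ) :
      2 * ∫⁻ y in graphSlab h e x ρ (T / 2 ^ (k + 1 + 1)) (T / 2 ^ (k + 1)), ‖f y - c‖ₑ
        ≤ (∫⁻ y in graphSlab h e x ρ (T / 2 ^ (k + 1)) (T / 2 ^ k), ‖f y - c‖ₑ)
          + 3 * m * (2 ^ (n + 1) * bmoSeminorm Ω f) * W k := by
    have ha : 0 < T / 2 ^ (k + 2) := by positivity
    have haT : T / 2 ^ (k + 2) ≤ T / 2 := by
      gcongr
      exact le_self_pow₀ one_le_two (by omega)
    have hstep := G.height.two_mul_setLIntegral_layer_le (μ := volume) (x := x) (ρ := ρ) hf c ha.le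
      (div_nonneg ha.le m.cast_nonneg) (mul_div_cancel₀ _ G.steps_pos.ne')
      fun _ _ => G.setLIntegral_enorm_sub_shift_le hf ha haT
    rw [show 2 * (T / 2 ^ (k + 2)) = T / 2 ^ (k + 1) by rw [pow_succ _ (k + 1)]; field_simp,
      show 4 * (T / 2 ^ (k + 2)) = T / 2 ^ k by rw [pow_add]; field_simp; norm_num,
      show 8 * (T / 2 ^ (k + 2)) = 2 * T / 2 ^ k by rw [pow_add]; field_simp; norm_num] at hstep
    rwa [mul_assoc (3 * (m : ℝ≥0∞))]
  refine (setLIntegral_graphSlab_le_tsum _ h e x ρ hT _).trans ?_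
  simpa only [W, pow_zero, div_one, zero_add, pow_one] using tsum_le_of_two_mul_succ_le
    (J := fun k => ∫⁻ y in graphSlab h e x ρ (T / 2 ^ (k + 1)) (T / 2 ^ k), ‖f y - c‖ₑ) hW hlayer

lemma ball_top_subset (G : IsNearGraph Ω h e Λ x ρ T m) :
    ball (x + (T - h x) • e) (ρ + Λ * ρ + T / 2 / m) ⊆ Ω := by
  intro z hz
  rw [mem_ball_iff_norm] at hz
  have hT := G.top_pos
  have hsmall := G.six_mul_mul_step_le (half_pos hT).le
  have hstep := G.step_le_mul_step (half_pos hT).le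
  have hcenter : ‖x + (T - h x) • e - x‖ ≤ T := by
    rw [add_sub_cancel_left, norm_smul, G.height.norm_dir, mul_one, Real.norm_eq_abs]
    exact G.abs_sub_base_le hT.le le_rfl (by linarith)
  have htop : h (x + (T - h x) • e) = T := by rw [G.height.add_smul]; ring
  have hheight := abs_le.1 (G.height.abs_sub_le_mul hz.le)
  have hradius : Λ * (ρ + Λ * ρ + T / 2 / m) < T := by
    linarith [G.top_eq, show Λ * (ρ + Λ * ρ) = 2 * Λ * (1 + Λ) * ρ / 2 by ring]
  refine G.above z ?_ (by linarith)
  linarith [norm_sub_le_norm_sub_add_norm_sub z (x + (T - h x) • e) x, G.mul_le_half_top]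

lemma exists_setLIntegral_top_slice_le (G : IsNearGraph Ω h e Λ x ρ T m) (f : Vec n → E) :
    ∃ c : E, ∫⁻ y in graphSlab h e x ρ T (T + T / 2 / m), ‖f y - c‖ₑ
      ≤ bmoSeminorm Ω f * volume (ball x (6 * T)) := by
  have hT := G.top_pos
  set r := ρ + Λ * ρ + T / 2 / m
  have hr : 0 < r := by
    have := G.pos
    have := G.height.one_le
    positivity
  have hrT : r ≤ 6 * T := by
    linarith [G.mul_le_half_top, G.step_le le_rfl, G.height.one_le, G.pos,
      mul_pos (zero_lt_one.trans_le G.height.one_le) G.pos]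
  refine ⟨⨍ w in ball (x + (T - h x) • e) r, f w, ?_⟩
  calc _ ≤ ∫⁻ y in ball (x + (T - h x) • e) r,
          ‖f y - ⨍ w in ball (x + (T - h x) • e) r, f w‖ₑ := by
        refine lintegral_mono_set fun y hy => ?_
        have hslice : |h y - T| ≤ T / 2 / m := by
          rw [abs_of_pos (sub_pos.2 hy.2.1), sub_le_iff_le_add']
          exact hy.2.2
        rw [mem_ball_iff_norm]
        linarith [G.height.norm_sub_lt_of_mem_graphSlab hy T]
    _ ≤ bmoSeminorm Ω f * volume (ball (x + (T - h x) • e) r) :=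
        lintegral_sub_average_le_bmoSeminorm f hr G.ball_top_subset
    _ ≤ bmoSeminorm Ω f * volume (ball x (6 * T)) := by
        rw [Measure.addHaar_ball_center, ← Measure.addHaar_ball_center volume x]
        gcongr

lemma ball_inter_subset_graphSlab (G : IsNearGraph Ω h e Λ x ρ T m)
    (hΩ : ∀ z ∈ Ω, ‖z - x‖ < 4 * T → 0 < h z) : ball x ρ ∩ Ω ⊆ graphSlab h e x ρ 0 T := by
  rintro y ⟨hyx, hyΩ⟩
  refine ⟨mem_ballCylinder_of_mem_ball hyx, ?_⟩
  rw [mem_ball_iff_norm] at hyx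
  have hρT : 0 ≤ Λ * ρ := mul_nonneg (by linarith [G.height.one_le]) G.pos.le
  have hheight := abs_le.1 (G.height.abs_sub_le_mul hyx.le)
  have htop : 2 * (Λ * ρ) ≤ T := by
    nlinarith [G.top_eq, mul_nonneg hρT (by linarith [G.height.one_le] : (0 : ℝ) ≤ Λ)]
  exact ⟨hΩ y hyΩ (by linarith [G.mul_le_half_top, G.top_pos]), by linarith [G.base_le]⟩

lemma exists_setLIntegral_ball_inter_le (G : IsNearGraph Ω h e Λ x ρ T m) (hf : Continuous f)
    (hΩ : ∀ z ∈ Ω, ‖z - x‖ < 4 * T → 0 < h z) :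
    ∃ c : E, ∫⁻ y in ball x ρ ∩ Ω, ‖f y - c‖ₑ
      ≤ (2 * m * (1 + m * 2 ^ (n + 1)) + 6 * m * 2 ^ (n + 1)) * bmoSeminorm Ω f *
        volume (ball x (6 * T)) := by
  have hT := half_pos G.top_pos
  obtain ⟨c, hc⟩ := G.exists_setLIntegral_top_slice_le f
  have hslab {β : ℝ} (hβ : β ≤ 4 * T) :
      volume (graphSlab h e x (2 * ρ) 0 β) ≤ volume (ball x (6 * T)) :=
    measure_mono ((G.graphSlab_subset_ball le_rfl hβ (by linarith)).trans
      (ball_subset_ball (by linarith)))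
  have hstep : T / 2 / m ≤ 2 * (T / 2) := by
    linarith [G.six_mul_mul_step_le hT.le, G.step_le_mul_step hT.le]
  have htop := G.height.setLIntegral_layer_le (μ := volume) (x := x) (ρ := ρ) hf c
    (div_nonneg hT.le m.cast_nonneg) hstep (mul_div_cancel₀ _ G.steps_pos.ne')
    fun _ _ => G.setLIntegral_enorm_sub_shift_le hf hT le_rfl
  rw [show 2 * (T / 2) = T by ring, show 8 * (T / 2) = 4 * T by ring] at htop
  refine ⟨c, ?_⟩
  set b := bmoSeminorm Ω f
  set B := volume (ball x (6 * T))
  calc ∫⁻ y in ball x ρ ∩ Ω, ‖f y - c‖ₑ ≤ ∫⁻ y in graphSlab h e x ρ 0 T, ‖f y - c‖ₑ :=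
        lintegral_mono_set (G.ball_inter_subset_graphSlab hΩ)
    _ ≤ _ := G.setLIntegral_graphSlab_le hf c
    _ ≤ 2 * (m * (b * B + m * (2 ^ (n + 1) * b * B)))
          + 3 * m * (2 ^ (n + 1) * b) * (2 * B) := by
        gcongr
        · refine htop.trans ?_
          gcongr
          exact hslab le_rfl
        · exact hslab (by linarith)
    _ = _ := by ring

end IsNearGraph

end NearGraph

section OscillationBound

variable {n : ℕ} {E : Type*} [NormedAddCommGroup E] [NormedSpace ℝ E] {Ω : Set (Vec n)}
  {A B : NNReal} {x : Vec n} {ρ : ℝ}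

/-- `Ω` fills a fixed proportion of `B(x, ρ)`, and the mean oscillation over `B(x, ρ) ∩ Ω` is
controlled by the one over the balls contained in `Ω`. -/
structure HasOscillationBound (E : Type*) [NormedAddCommGroup E] [NormedSpace ℝ E]
    (Ω : Set (Vec n)) (A : NNReal) (x : Vec n) (ρ : ℝ) : Prop where
  volume_le : volume (ball x ρ) ≤ A * volume (ball x ρ ∩ Ω)
  exists_lintegral_sub_le : ∀ f : Vec n → E, Continuous f → ∃ c : E,
    ∫⁻ y in ball x ρ ∩ Ω, ‖f y - c‖ₑ ≤ A * bmoSeminorm Ω f * volume (ball x ρ)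

lemma HasOscillationBound.mono (H : HasOscillationBound E Ω A x ρ) (hAB : A ≤ B) :
    HasOscillationBound E Ω B x ρ where
  volume_le := H.volume_le.trans (by gcongr)
  exists_lintegral_sub_le f hf := by
    obtain ⟨c, hc⟩ := H.exists_lintegral_sub_le f hf
    exact ⟨c, hc.trans (by gcongr)⟩

lemma HasOscillationBound.lintegral_sub_average_le [CompleteSpace E]
    (H : HasOscillationBound E Ω A x ρ) {f : Vec n → E} (hf : Continuous f) :
    ∫⁻ y in ball x ρ ∩ Ω, ‖f y - ⨍ z in ball x ρ ∩ Ω, f z‖ₑ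
      ≤ 2 * A * bmoSeminorm Ω f * volume (ball x ρ) := by
  obtain ⟨c, hc⟩ := H.exists_lintegral_sub_le f hf
  have hfin : IsFiniteMeasure (volume.restrict (ball x ρ ∩ Ω)) :=
    ⟨by simpa using (measure_mono inter_subset_left).trans_lt measure_ball_lt_top⟩
  have hfint : IntegrableOn f (ball x ρ ∩ Ω) :=
    (hf.continuousOn.integrableOn_compact (isCompact_closedBall x ρ)).mono_set
      (inter_subset_left.trans ball_subset_closedBall)
  calc _ ≤ 2 * ∫⁻ y in ball x ρ ∩ Ω, ‖f y - c‖ₑ := lintegral_enorm_sub_average_le hfint c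
    _ ≤ 2 * (A * bmoSeminorm Ω f * volume (ball x ρ)) := by gcongr
    _ = _ := by ring

lemma hasOscillationBound_of_ball_subset (hρ : 0 < ρ) (h : ball x ρ ⊆ Ω) :
    HasOscillationBound E Ω 1 x ρ where
  volume_le := by rw [inter_eq_left.2 h, ENNReal.coe_one, one_mul]
  exists_lintegral_sub_le f _ := by
    rw [inter_eq_left.2 h, ENNReal.coe_one, one_mul]
    exact ⟨_, lintegral_sub_average_le_bmoSeminorm f hρ h⟩

end OscillationBound

section LipschitzGraph

lemma norm_sub_inner_smul_sub_le {V : Type*} [NormedAddCommGroup V] [InnerProductSpace ℝ V]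
    {e : V} (he : ‖e‖ = 1) (y z : V) :
    ‖y - inner ℝ e y • e - (z - inner ℝ e z • e)‖ ≤ 2 * ‖y - z‖ := by
  have hinner : |inner ℝ e (y - z)| ≤ ‖y - z‖ := by
    simpa only [he, one_mul] using abs_real_inner_le_norm e (y - z)
  calc _ = ‖(y - z) - inner ℝ e (y - z) • e‖ := by rw [inner_sub_right]; congr 1; module
    _ ≤ ‖y - z‖ + |inner ℝ e (y - z)| := by
      simpa only [norm_smul, he, mul_one, Real.norm_eq_abs] using
        norm_sub_le (y - z) (inner ℝ e (y - z) • e)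
    _ ≤ 2 * ‖y - z‖ := by linarith

lemma isGraphHeight_of_lipschitzWith {V : Type*} [NormedAddCommGroup V] [InnerProductSpace ℝ V]
    {e : V} (he : ‖e‖ = 1) {K : NNReal} {ψ : V → ℝ} (hψ : LipschitzWith K ψ) :
    IsGraphHeight (fun y => inner ℝ e y - ψ (y - inner ℝ e y • e)) e (1 + 2 * K) where
  norm_dir := he
  abs_sub_le y z := by
    have hinner : |inner ℝ e (y - z)| ≤ ‖y - z‖ := by
      simpa only [he, one_mul] using abs_real_inner_le_norm e (y - z)
    have hgraph : |ψ (y - inner ℝ e y • e) - ψ (z - inner ℝ e z • e)| ≤ K * (2 * ‖y - z‖) := by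
      rw [← Real.dist_eq]
      refine (hψ.dist_le_mul _ _).trans ?_
      rw [dist_eq_norm]
      gcongr
      exact norm_sub_inner_smul_sub_le he y z
    calc _ = |inner ℝ e (y - z) - (ψ (y - inner ℝ e y • e) - ψ (z - inner ℝ e z • e))| := by
          rw [inner_sub_right]; ring_nf
      _ ≤ ‖y - z‖ + K * (2 * ‖y - z‖) := (abs_sub _ _).trans (add_le_add hinner hgraph)
      _ = _ := by ring
  add_smul y t := by
    have hinner : inner ℝ e (y + t • e) = inner ℝ e y + t := by
      rw [inner_add_right, inner_smul_right, real_inner_self_eq_norm_sq, he, one_pow, mul_one]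
    have hproj : y + t • e - inner ℝ e (y + t • e) • e = y - inner ℝ e y • e := by
      rw [hinner]; module
    rw [hproj, hinner]; ring

variable {n : ℕ} {E : Type*} [NormedAddCommGroup E] [NormedSpace ℝ E] {Ω : Set (Vec n)}
  {h : Vec n → ℝ} {e x : Vec n} {Λ ρ : ℝ}

lemma IsGraphHeight.ball_subset_ball_inter (H : IsGraphHeight h e Λ) (hρ : 0 < ρ) (hx : 0 ≤ h x)
    (habove : ∀ z ∈ ball x ρ, 0 < h z → z ∈ Ω) :
    ball (x + (ρ / 2) • e) (ρ / (2 * Λ)) ⊆ ball x ρ ∩ Ω := by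
  intro z hz
  have hΛ : 0 < Λ := zero_lt_one.trans_le H.one_le
  rw [mem_ball_iff_norm] at hz
  have hradius : ρ / (2 * Λ) ≤ ρ / 2 := by
    gcongr
    linarith [H.one_le]
  have hnorm : ‖x + (ρ / 2) • e - x‖ = ρ / 2 := by
    rw [add_sub_cancel_left, norm_smul, H.norm_dir, mul_one, Real.norm_of_nonneg (by positivity)]
  have hzx : z ∈ ball x ρ := by
    rw [mem_ball_iff_norm]
    linarith [norm_sub_le_norm_sub_add_norm_sub z (x + (ρ / 2) • e) x]
  refine ⟨hzx, habove z hzx ?_⟩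
  have hheight := neg_le_of_abs_le (H.abs_sub_le z (x + (ρ / 2) • e))
  rw [H.add_smul] at hheight
  have hlt : Λ * ‖z - (x + (ρ / 2) • e)‖ < ρ / 2 := by
    calc _ < Λ * (ρ / (2 * Λ)) := by gcongr
      _ = ρ / 2 := by field_simp
  linarith

lemma IsGraphHeight.volume_ball_le (H : IsGraphHeight h e Λ) (hρ : 0 < ρ) (hx : 0 ≤ h x)
    (habove : ∀ z ∈ ball x ρ, 0 < h z → z ∈ Ω) :
    volume (ball x ρ) ≤ ENNReal.ofReal (2 * Λ) ^ n * volume (ball x ρ ∩ Ω) := by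
  have hΛ : 0 < Λ := zero_lt_one.trans_le H.one_le
  calc volume (ball x ρ) = volume (ball x (2 * Λ * (ρ / (2 * Λ)))) := by
        congr 2
        field_simp
    _ = ENNReal.ofReal (2 * Λ) ^ n * volume (ball (x + (ρ / 2) • e) (ρ / (2 * Λ))) :=
        volume_ball_mul x _ (by positivity)
    _ ≤ _ := by
        gcongr
        exact H.ball_subset_ball_inter hρ hx habove

/-- The constant produced by the near-graph estimate: the first entry bounds the ratio of volumes,
the second one the oscillation. -/
def nearGraphConst (n : ℕ) (Λ : ℝ) (m : ℕ) : NNReal :=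
  max (Real.toNNReal (2 * Λ) ^ n)
    ((2 * m * (1 + m * 2 ^ (n + 1)) + 6 * m * 2 ^ (n + 1)) *
      Real.toNNReal (12 * Λ * (1 + Λ)) ^ n)

lemma IsNearGraph.hasOscillationBound {T : ℝ} {m : ℕ} (G : IsNearGraph Ω h e Λ x ρ T m)
    (hΩ : ∀ z ∈ Ω, ‖z - x‖ < 4 * T → 0 < h z) :
    HasOscillationBound E Ω (nearGraphConst n Λ m) x ρ where
  volume_le := by
    have hT : ρ < 4 * T := by
      linarith [G.mul_le_half_top, G.top_pos,
        mul_nonneg (zero_le_one.trans G.height.one_le) G.pos.le]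
    refine (G.height.volume_ball_le (Ω := Ω) G.pos G.base_nonneg fun z hz =>
      G.above z ((mem_ball_iff_norm.1 hz).trans hT)).trans ?_
    gcongr
    rw [nearGraphConst]
    push_cast
    exact le_max_left _ _
  exists_lintegral_sub_le f hf := by
    have hΛ := G.height.one_le
    obtain ⟨c, hc⟩ := G.exists_setLIntegral_ball_inter_le hf hΩ
    refine ⟨c, hc.trans ?_⟩
    rw [show 6 * T = 12 * Λ * (1 + Λ) * ρ by rw [G.top_eq]; ring,
      volume_ball_mul x x (by positivity)]
    calc _ = ((2 * m * (1 + m * 2 ^ (n + 1)) + 6 * m * 2 ^ (n + 1)) *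
            ENNReal.ofReal (12 * Λ * (1 + Λ)) ^ n) * bmoSeminorm Ω f * volume (ball x ρ) := by ring
      _ ≤ _ := by
        gcongr
        rw [nearGraphConst]
        push_cast
        exact le_max_right _ _

lemma exists_hasOscillationBound_of_graph (H : IsGraphHeight h e Λ) {x₀ : Vec n} {R : ℝ}
    (hR : 0 < R) (hΩ : ∀ z ∈ ball x₀ R, (z ∈ Ω ↔ 0 < h z)) :
    ∃ r > 0, ∃ A : NNReal, ∀ x ∈ ball x₀ r ∩ Ω, ∀ ρ, 0 < ρ → ρ ≤ r →
      HasOscillationBound E Ω A x ρ := by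
  have hΛ := H.one_le
  obtain ⟨m, hm⟩ := exists_nat_gt (3 * Λ * (1 + Λ))
  refine ⟨R / (8 * Λ * (1 + Λ) + 1), by positivity, max 1 (nearGraphConst n Λ m), ?_⟩
  rintro x ⟨hx, hxΩ⟩ ρ hρ hρr
  set T := 2 * Λ * (1 + Λ) * ρ with hT
  have hTR : 4 * T + ‖x - x₀‖ < R := by
    rw [mem_ball_iff_norm] at hx
    calc 4 * T + ‖x - x₀‖ = 8 * Λ * (1 + Λ) * ρ + ‖x - x₀‖ := by rw [hT]; ring
      _ < 8 * Λ * (1 + Λ) * (R / (8 * Λ * (1 + Λ) + 1)) + R / (8 * Λ * (1 + Λ) + 1) :=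
        add_lt_add_of_le_of_lt (by gcongr) hx
      _ = R := by field_simp
  have hlocal : ∀ z, ‖z - x‖ < 4 * T → (z ∈ Ω ↔ 0 < h z) := fun z hz =>
    hΩ z (mem_ball_iff_norm.2 (by linarith [norm_sub_le_norm_sub_add_norm_sub z x x₀]))
  have hhx : 0 < h x := (hlocal x (by rw [sub_self, norm_zero]; positivity)).1 hxΩ
  rcases le_or_gt (Λ * ρ) (h x) with hfar | hnear
  · have hρT : ρ ≤ 4 * T := by nlinarith [mul_pos (zero_lt_one.trans_le hΛ) hρ]
    refine (hasOscillationBound_of_ball_subset hρ fun z hz => ?_).mono (le_max_left _ _)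
    rw [mem_ball_iff_norm] at hz
    have hlt : Λ * ‖z - x‖ < Λ * ρ := by gcongr
    exact (hlocal z (by linarith)).2 (by linarith [neg_le_of_abs_le (H.abs_sub_le z x)])
  · have G : IsNearGraph Ω h e Λ x ρ T m :=
      ⟨H, hρ, hT, hm, hhx.le, hnear.le, fun z hz => (hlocal z hz).2⟩
    exact (G.hasOscillationBound fun z hz hzT => (hlocal z hzT).1 hz).mono (le_max_right _ _)

end LipschitzGraph

section LipschitzDomain

variable {n : ℕ} {E : Type*} [NormedAddCommGroup E] [NormedSpace ℝ E] {Ω : Set (Vec n)}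

lemma IsLipschitzDomain.exists_nhds_hasOscillationBound (hΩ : IsLipschitzDomain Ω) {x₀ : Vec n}
    (hx₀ : x₀ ∈ closure Ω) :
    ∃ s ∈ 𝓝 x₀, ∃ r > 0, ∃ A : NNReal, ∀ x ∈ s ∩ Ω, ∀ ρ, 0 < ρ → ρ ≤ r →
      HasOscillationBound E Ω A x ρ := by
  by_cases hx : x₀ ∈ Ω
  · obtain ⟨R, hR, hsub⟩ := Metric.isOpen_iff.1 hΩ.isOpen x₀ hx
    refine ⟨ball x₀ (R / 2), ball_mem_nhds _ (half_pos hR), R / 2, half_pos hR, 1,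
      fun x hx ρ hρ hρR => ?_⟩
    refine hasOscillationBound_of_ball_subset hρ ((ball_subset_ball' ?_).trans hsub)
    linarith [mem_ball.1 hx.1]
  · have hfrontier : x₀ ∈ frontier Ω := by
      rw [hΩ.isOpen.frontier_eq]
      exact ⟨hx₀, hx⟩
    obtain ⟨e, R, K, ψ, he, hR, hψ, hgraph⟩ := hΩ.graph x₀ hfrontier
    obtain ⟨r, hr, A, hA⟩ := exists_hasOscillationBound_of_graph (E := E)
      (isGraphHeight_of_lipschitzWith he hψ) hR fun z hz => by rw [hgraph z hz, sub_pos]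
    exact ⟨ball x₀ r, ball_mem_nhds _ hr, r, hr, A, hA⟩

lemma IsLipschitzDomain.exists_hasOscillationBound (hΩ : IsLipschitzDomain Ω) :
    ∃ r > 0, ∃ A : NNReal, ∀ x ∈ Ω, ∀ ρ, 0 < ρ → ρ ≤ r → HasOscillationBound E Ω A x ρ := by
  have hclosure : ∃ r > 0, ∃ A : NNReal, ∀ x ∈ closure Ω ∩ Ω, ∀ ρ, 0 < ρ → ρ ≤ r →
      HasOscillationBound E Ω A x ρ := by
    refine hΩ.bounded.isCompact_closure.induction_on ⟨1, one_pos, 0, by simp⟩ ?_ ?_ ?_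
    · rintro s t hst ⟨r, hr, A, hA⟩
      exact ⟨r, hr, A, fun x hx => hA x ⟨hst hx.1, hx.2⟩⟩
    · rintro s t ⟨r, hr, A, hA⟩ ⟨r', hr', A', hA'⟩
      refine ⟨min r r', lt_min hr hr', max A A', ?_⟩
      rintro x ⟨hx | hx, hxΩ⟩ ρ hρ hρr
      · exact (hA x ⟨hx, hxΩ⟩ ρ hρ (hρr.trans (min_le_left _ _))).mono (le_max_left _ _)
      · exact (hA' x ⟨hx, hxΩ⟩ ρ hρ (hρr.trans (min_le_right _ _))).mono (le_max_right _ _)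
    · intro x₀ hx₀
      obtain ⟨s, hs, hbound⟩ := hΩ.exists_nhds_hasOscillationBound (E := E) hx₀
      exact ⟨s, mem_nhdsWithin_of_mem_nhds hs, hbound⟩
  simpa only [inter_eq_right.2 subset_closure] using hclosure

end LipschitzDomain

section Poincare

variable {n : ℕ} {E : Type*} [NormedAddCommGroup E] [NormedSpace ℝ E] [CompleteSpace E]
  {Ω : Set (Vec n)} {A : NNReal} {r : ℝ}

lemma enorm_average_sub_average_mul_le {x y : Vec n} (hx : HasOscillationBound E Ω A x r)
    (hy : HasOscillationBound E Ω A y r) {f : Vec n → E} (hf : Continuous f) :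
    ‖(⨍ z in ball x r ∩ Ω, f z) - ⨍ z in ball y r ∩ Ω, f z‖ₑ * volume (ball x r ∩ ball y r ∩ Ω)
      ≤ 4 * A * bmoSeminorm Ω f * volume (ball (0 : Vec n) r) := by
  have hbound {w : Vec n} (hw : HasOscillationBound E Ω A w r)
      (hsub : ball x r ∩ ball y r ∩ Ω ⊆ ball w r ∩ Ω) :
      ∫⁻ z in ball x r ∩ ball y r ∩ Ω, ‖(⨍ z in ball w r ∩ Ω, f z) - f z‖ₑ
        ≤ 2 * A * bmoSeminorm Ω f * volume (ball (0 : Vec n) r) := by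
    simp only [enorm_sub_rev _ (f _)]
    rw [← Measure.addHaar_ball_center volume w]
    exact (lintegral_mono_set hsub).trans (hw.lintegral_sub_average_le hf)
  have hmeas : Measurable fun z => ‖(⨍ w in ball x r ∩ Ω, f w) - f z‖ₑ :=
    (continuous_const.sub hf).enorm.measurable
  rw [← Measure.restrict_apply_univ (μ := volume)]
  calc _ ≤ _ := enorm_sub_mul_measure_univ_le f _ _
    _ = _ := lintegral_add_left hmeas _
    _ ≤ _ := add_le_add (hbound hx (inter_subset_inter_left _ inter_subset_left))
      (hbound hy (inter_subset_inter_left _ inter_subset_right))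
    _ = _ := by ring

lemma exists_enorm_average_sub_average_le_of_mem_ball (hΩ : IsOpen Ω) {x y : Vec n} (hxΩ : x ∈ Ω)
    (hx : HasOscillationBound E Ω A x r) (hy : HasOscillationBound E Ω A y r)
    (hxy : x ∈ ball y r) :
    ∃ C : NNReal, ∀ f : Vec n → E, Continuous f →
      ‖(⨍ z in ball x r ∩ Ω, f z) - ⨍ z in ball y r ∩ Ω, f z‖ₑ ≤ C * bmoSeminorm Ω f := by
  set U := ball x r ∩ ball y r ∩ Ω
  have hU : volume U ≠ 0 := (((isOpen_ball.inter isOpen_ball).inter hΩ).measure_pos volume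
    ⟨x, ⟨mem_ball_self (dist_nonneg.trans_lt hxy), hxy⟩, hxΩ⟩).ne'
  have hUtop : volume U ≠ ⊤ := ne_top_of_le_ne_top measure_ball_lt_top.ne
    (measure_mono (inter_subset_left.trans inter_subset_left))
  have hVtop : volume (ball (0 : Vec n) r) ≠ ⊤ := measure_ball_lt_top.ne
  have hC : 4 * A * volume (ball (0 : Vec n) r) / volume U ≠ ⊤ :=
    ENNReal.div_ne_top (by finiteness) hU
  refine ⟨(4 * A * volume (ball (0 : Vec n) r) / volume U).toNNReal, fun f hf => ?_⟩
  rw [ENNReal.coe_toNNReal hC]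
  have hle := enorm_average_sub_average_mul_le hx hy hf
  rw [← ENNReal.le_div_iff_mul_le (Or.inl hU) (Or.inl hUtop)] at hle
  refine hle.trans_eq ?_
  simp only [ENNReal.div_eq_inv_mul]
  ring

lemma exists_enorm_average_sub_average_le (hΩ : IsOpen Ω) (hconn : IsPreconnected Ω) (hr : 0 < r)
    (hosc : ∀ x ∈ Ω, HasOscillationBound E Ω A x r) {x y : Vec n} (hx : x ∈ Ω) (hy : y ∈ Ω) :
    ∃ C : NNReal, ∀ f : Vec n → E, Continuous f →
      ‖(⨍ z in ball x r ∩ Ω, f z) - ⨍ z in ball y r ∩ Ω, f z‖ₑ ≤ C * bmoSeminorm Ω f := by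
  refine hconn.induction₂ (fun x y => ∃ C : NNReal, ∀ f : Vec n → E, Continuous f →
    ‖(⨍ z in ball x r ∩ Ω, f z) - ⨍ z in ball y r ∩ Ω, f z‖ₑ ≤ C * bmoSeminorm Ω f) ?_ ?_ ?_ hx hy
  · intro x hx
    filter_upwards [mem_nhdsWithin_of_mem_nhds (ball_mem_nhds x hr), self_mem_nhdsWithin]
      with y hy hyΩ
    exact exists_enorm_average_sub_average_le_of_mem_ball hΩ hx (hosc x hx) (hosc y hyΩ)
      (mem_ball_comm.1 hy)
  · rintro x y z - - - ⟨C, hC⟩ ⟨D, hD⟩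
    refine ⟨C + D, fun f hf => ?_⟩
    rw [ENNReal.coe_add, add_mul]
    refine le_trans ?_ (add_le_add (hC f hf) (hD f hf))
    simpa only [edist_eq_enorm_sub] using edist_triangle (⨍ w in ball x r ∩ Ω, f w) _ _
  · rintro x y - - ⟨C, hC⟩
    exact ⟨C, fun f hf => by rw [enorm_sub_rev]; exact hC f hf⟩

lemma setLIntegral_biUnion_finset_le {α ι : Type*} [MeasurableSpace α] {μ : Measure α}
    (t : Finset ι) (s : ι → Set α) (g : α → ℝ≥0∞) :
    ∫⁻ y in ⋃ i ∈ t, s i, g y ∂μ ≤ ∑ i ∈ t, ∫⁻ y in s i, g y ∂μ := by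
  calc ∫⁻ y in ⋃ i ∈ t, s i, g y ∂μ = ∫⁻ y in ⋃ i : t, s i, g y ∂μ := by rw [iUnion_subtype]
    _ ≤ ∑' i : t, ∫⁻ y in s i, g y ∂μ := lintegral_iUnion_le _ _
    _ = ∑ i ∈ t, ∫⁻ y in s i, g y ∂μ := t.tsum_subtype fun i => ∫⁻ y in s i, g y ∂μ

lemma IsLipschitzDomain.exists_lintegral_sub_le_bmoSeminorm (hΩ : IsLipschitzDomain Ω) :
    ∃ C : NNReal, ∀ f : Vec n → E, Continuous f →
      ∃ c : E, ∫⁻ x in Ω, ‖f x - c‖ₑ ≤ C * bmoSeminorm Ω f := by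
  obtain ⟨r, hr, A, hA⟩ := hΩ.exists_hasOscillationBound (E := E)
  have hosc (x) (hx : x ∈ Ω) := hA x hx r hr le_rfl
  obtain ⟨p, hp⟩ := hΩ.connected.nonempty
  choose! D hD using fun x hx => exists_enorm_average_sub_average_le (x := x) hΩ.isOpen
    hΩ.connected.isPreconnected hr hosc hx hp
  obtain ⟨t, htΩ, htfin, hcover⟩ := finite_approx_of_totallyBounded
    (hΩ.bounded.isCompact_closure.totallyBounded.subset subset_closure) r hr
  lift t to Finset (Vec n) using htfin
  set V := volume (ball (0 : Vec n) r)
  have hVtop : V ≠ ⊤ := measure_ball_lt_top.ne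
  have hball (f : Vec n → E) (hf : Continuous f) (x) (hx : x ∈ t) :
      ∫⁻ y in ball x r ∩ Ω, ‖f y - ⨍ z in ball p r ∩ Ω, f z‖ₑ
        ≤ (2 * A + D x) * V * bmoSeminorm Ω f := by
    calc _ ≤ _ := lintegral_enorm_sub_le_add f (⨍ z in ball x r ∩ Ω, f z) _
      _ ≤ 2 * A * bmoSeminorm Ω f * volume (ball x r)
          + D x * bmoSeminorm Ω f * volume (ball x r) := by
        rw [Measure.restrict_apply_univ]
        gcongr
        · exact (hosc x (htΩ hx)).lintegral_sub_average_le hf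
        · exact hD x (htΩ hx) f hf
        · exact inter_subset_left
      _ = _ := by rw [Measure.addHaar_ball_center]; ring
  have hS : ∑ x ∈ t, (2 * A + D x) * V ≠ ⊤ := ENNReal.sum_ne_top.2 fun x _ => by finiteness
  refine ⟨(∑ x ∈ t, (2 * A + D x) * V).toNNReal, fun f hf => ⟨⨍ z in ball p r ∩ Ω, f z, ?_⟩⟩
  rw [ENNReal.coe_toNNReal hS, Finset.sum_mul]
  have hsub : Ω ⊆ ⋃ x ∈ t, ball x r ∩ Ω := by
    rw [← iUnion₂_inter]
    exact subset_inter hcover subset_rfl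
  exact (lintegral_mono_set hsub).trans ((setLIntegral_biUnion_finset_le t _ _).trans
    (Finset.sum_le_sum fun x hx => hball f hf x hx))

lemma IsLipschitzDomain.exists_lintegral_le_bmoSeminorm (hΩ : IsLipschitzDomain Ω) :
    ∃ C : NNReal, ∀ f : Vec n → E, Continuous f → IntegrableOn f Ω → ∫ x in Ω, f x = 0 →
      ∫⁻ x in Ω, ‖f x‖ₑ ≤ C * bmoSeminorm Ω f := by
  obtain ⟨C, hC⟩ := hΩ.exists_lintegral_sub_le_bmoSeminorm (E := E)
  have : IsFiniteMeasure (volume.restrict Ω) := ⟨by simpa using hΩ.bounded.measure_lt_top⟩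
  refine ⟨2 * C, fun f hf hfint hmean => ?_⟩
  obtain ⟨c, hc⟩ := hC f hf
  calc ∫⁻ x in Ω, ‖f x‖ₑ = ∫⁻ x in Ω, ‖f x - ⨍ z in Ω, f z‖ₑ := by
        simp only [setAverage_eq, hmean, smul_zero, sub_zero]
    _ ≤ 2 * ∫⁻ x in Ω, ‖f x - c‖ₑ := lintegral_enorm_sub_average_le hfint c
    _ ≤ 2 * (C * bmoSeminorm Ω f) := by gcongr
    _ = _ := by push_cast; ring

end Poincare

section DyadicLevels

lemma sum_range_two_pow_mul_le (l : ℝ≥0∞) (N : ℕ) :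
    ∑ k ∈ Finset.range N, 2 ^ k * l ≤ 2 ^ N * l := by
  induction N with
  | zero => simp
  | succ N ih =>
    rw [Finset.sum_range_succ, pow_succ, mul_assoc, two_mul, mul_add]
    exact add_le_add_left ih _

lemma tsum_two_pow_mul_le (l X : ℝ≥0∞) :
    ∑' k : ℕ, (if 2 ^ k * l < X then 2 ^ k * l else 0) ≤ 2 * X := by
  refine ENNReal.tsum_le_of_sum_range_le fun N => ?_
  induction N with
  | zero => simp
  | succ N ih =>
    rw [Finset.sum_range_succ]
    split_ifs with hN
    · rw [two_mul]
      refine add_le_add ?_ hN.le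
      calc _ ≤ ∑ k ∈ Finset.range N, 2 ^ k * l :=
            Finset.sum_le_sum fun k _ => by split_ifs <;> simp
        _ ≤ X := (sum_range_two_pow_mul_le l N).trans hN.le
    · rwa [add_zero]

lemma mul_tsum_two_pow_mul_pow_le (l X : ℝ≥0∞) (j : ℕ) :
    l * ∑' k : ℕ, (if 2 ^ k * l < X then (2 ^ k * l) ^ (j + 1) else 0) ≤ 2 * X ^ (j + 2) := by
  calc l * ∑' k : ℕ, (if 2 ^ k * l < X then (2 ^ k * l) ^ (j + 1) else 0)
      = ∑' k : ℕ, l * (if 2 ^ k * l < X then (2 ^ k * l) ^ (j + 1) else 0) :=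
        ENNReal.tsum_mul_left.symm
    _ ≤ ∑' k : ℕ, X ^ (j + 1) * (if 2 ^ k * l < X then 2 ^ k * l else 0) := by
        refine ENNReal.tsum_le_tsum fun k => ?_
        split_ifs with hk
        · have hl : l ≤ X := (le_mul_of_one_le_left' (one_le_pow₀ one_le_two)).trans hk.le
          calc l * (2 ^ k * l) ^ (j + 1) ≤ X * (X ^ j * (2 ^ k * l)) := by
                rw [pow_succ]
                gcongr
            _ = _ := by ring
        · simp
    _ ≤ X ^ (j + 1) * (2 * X) := by
        rw [ENNReal.tsum_mul_left]
        gcongr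
        exact tsum_two_pow_mul_le l X
    _ = _ := by ring

lemma exists_two_pow_mul_lt_and_le {l g : ℝ≥0∞} (hl : l ≠ 0) (hg : g ≠ ⊤) (hlg : l < g) :
    ∃ k : ℕ, 2 ^ k * l < g ∧ g ≤ 2 ^ (k + 1) * l := by
  have hlim : Tendsto (fun k : ℕ => (2 : ℝ≥0∞) ^ k * l) atTop (𝓝 (⊤ * l)) :=
    ENNReal.Tendsto.mul_const (ENNReal.tendsto_pow_atTop_nhds_top_iff.2 ENNReal.one_lt_two)
      (Or.inl ENNReal.top_ne_zero)
  rw [ENNReal.top_mul hl] at hlim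
  have hex : ∃ k : ℕ, g ≤ 2 ^ k * l := ((hlim.eventually (lt_mem_nhds hg.lt_top)).mono
    fun _ => le_of_lt).exists
  obtain ⟨k, hk⟩ := Nat.exists_eq_succ_of_ne_zero fun h0 : Nat.find hex = 0 => by
    simpa [h0, hlg.not_ge] using Nat.find_spec hex
  have hspec := Nat.find_spec hex
  rw [hk] at hspec
  exact ⟨k, not_le.1 (Nat.find_min hex (by omega)), hspec⟩

lemma pow_le_add_tsum {l g : ℝ≥0∞} (hl : l ≠ 0) (hg : g ≠ ⊤) (j : ℕ) :
    g ^ (j + 3) ≤ (2 * l) ^ (j + 1) * g ^ 2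
      + ∑' k : ℕ, (if 2 * (2 ^ k * l) < g then (4 * (2 ^ k * l)) ^ (j + 3) else 0) := by
  rcases le_or_gt g (2 * l) with hsmall | hlarge
  · refine le_add_of_le_left ?_
    calc g ^ (j + 3) = g ^ (j + 1) * g ^ 2 := by ring
      _ ≤ _ := by gcongr
  · obtain ⟨k, hlt, hle⟩ := exists_two_pow_mul_lt_and_le (by simp [hl]) hg hlarge
    rw [mul_left_comm] at hlt
    refine le_add_of_le_right (le_trans ?_ (ENNReal.le_tsum k))
    rw [if_pos hlt]
    gcongr
    exact hle.trans_eq (by ring)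

variable {α : Type*} [MeasurableSpace α] {μ : Measure α} {g : α → ℝ≥0∞} {l κ : ℝ≥0∞}

lemma lintegral_pow_le_add_tsum (hg : Measurable g) (hgtop : ∀ x, g x ≠ ⊤) (hl : l ≠ 0) (j : ℕ) :
    ∫⁻ x, g x ^ (j + 3) ∂μ ≤ (2 * l) ^ (j + 1) * ∫⁻ x, g x ^ 2 ∂μ
      + ∑' k : ℕ, (4 * (2 ^ k * l)) ^ (j + 3) * μ {x | 2 * (2 ^ k * l) < g x} := by
  have hlevel (s : ℝ≥0∞) : MeasurableSet {x | s < g x} := measurableSet_lt measurable_const hg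
  calc ∫⁻ x, g x ^ (j + 3) ∂μ
      ≤ ∫⁻ x, ((2 * l) ^ (j + 1) * g x ^ 2 + ∑' k : ℕ, {x | 2 * (2 ^ k * l) < g x}.indicator
          (fun _ => (4 * (2 ^ k * l)) ^ (j + 3)) x) ∂μ := by
        refine lintegral_mono fun x => ?_
        simpa only [indicator_apply, mem_ofPred_eq] using pow_le_add_tsum hl (hgtop x) j
    _ = _ := by
        rw [lintegral_add_left ((hg.pow_const _).const_mul _),
          lintegral_const_mul _ (hg.pow_const _),
          lintegral_tsum fun k => (measurable_const.indicator (hlevel _)).aemeasurable]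
        simp only [lintegral_indicator_const (hlevel _)]

lemma mul_tsum_setLIntegral_le (hg : Measurable g) (l : ℝ≥0∞) (j : ℕ) :
    l * ∑' k : ℕ, (2 ^ k * l) ^ (j + 1) * ∫⁻ x in {x | 2 ^ k * l < 4 * g x}, g x ∂μ
      ≤ 2 * 4 ^ (j + 2) * ∫⁻ x, g x ^ (j + 3) ∂μ := by
  have hlevel (s : ℝ≥0∞) : MeasurableSet {x | s < 4 * g x} :=
    measurableSet_lt measurable_const (hg.const_mul _)
  have hmeas (k : ℕ) : Measurable ({x | 2 ^ k * l < 4 * g x}.indicator g) :=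
    hg.indicator (hlevel _)
  calc l * ∑' k : ℕ, (2 ^ k * l) ^ (j + 1) * ∫⁻ x in {x | 2 ^ k * l < 4 * g x}, g x ∂μ
      = ∫⁻ x, l * ∑' k : ℕ, (2 ^ k * l) ^ (j + 1) *
          {x | 2 ^ k * l < 4 * g x}.indicator g x ∂μ := by
        rw [lintegral_const_mul _ (Measurable.tsum fun k => (hmeas k).const_mul _),
          lintegral_tsum fun k => ((hmeas k).const_mul _).aemeasurable]
        simp only [lintegral_const_mul _ (hmeas _), lintegral_indicator (hlevel _)]
    _ ≤ ∫⁻ x, 2 * 4 ^ (j + 2) * g x ^ (j + 3) ∂μ := by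
        refine lintegral_mono fun x => ?_
        calc _ = (l * ∑' k : ℕ, (if 2 ^ k * l < 4 * g x then (2 ^ k * l) ^ (j + 1) else 0))
                * g x := by
              rw [mul_assoc, ← ENNReal.tsum_mul_right]
              simp only [indicator_apply, mem_ofPred_eq, mul_ite, ite_mul, mul_zero, zero_mul]
          _ ≤ 2 * (4 * g x) ^ (j + 2) * g x := by
              gcongr ?_ * _
              exact mul_tsum_two_pow_mul_pow_le l _ j
          _ = _ := by ring
    _ = _ := lintegral_const_mul _ (hg.pow_const _)

lemma tsum_mul_measure_le_of_weak_estimate (hg : Measurable g) (hl : l ≠ ⊤) (j : ℕ)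
    (hweak : ∀ s, l ≤ s → s ≠ ⊤ →
      s ^ 2 * μ {x | 2 * s < g x} ≤ κ * l * ∫⁻ x in {x | s < 4 * g x}, g x ∂μ) :
    ∑' k : ℕ, (4 * (2 ^ k * l)) ^ (j + 3) * μ {x | 2 * (2 ^ k * l) < g x}
      ≤ 2 * (4 ^ (2 * j + 5) * κ) * ∫⁻ x, g x ^ (j + 3) ∂μ := by
  have hlayer (k : ℕ) : (4 * (2 ^ k * l)) ^ (j + 3) * μ {x | 2 * (2 ^ k * l) < g x}
      ≤ 4 ^ (j + 3) * κ *
        (l * ((2 ^ k * l) ^ (j + 1) * ∫⁻ x in {x | 2 ^ k * l < 4 * g x}, g x ∂μ)) := by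
    calc _ = 4 ^ (j + 3) * (2 ^ k * l) ^ (j + 1) *
          ((2 ^ k * l) ^ 2 * μ {x | 2 * (2 ^ k * l) < g x}) := by ring
      _ ≤ 4 ^ (j + 3) * (2 ^ k * l) ^ (j + 1) *
          (κ * l * ∫⁻ x in {x | 2 ^ k * l < 4 * g x}, g x ∂μ) := by
        gcongr _ * ?_
        exact hweak _ (le_mul_of_one_le_left' (one_le_pow₀ one_le_two)) (by finiteness)
      _ = _ := by ring
  calc _ ≤ _ := ENNReal.tsum_le_tsum hlayer
    _ = 4 ^ (j + 3) * κ * (l * ∑' k : ℕ, (2 ^ k * l) ^ (j + 1) *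
        ∫⁻ x in {x | 2 ^ k * l < 4 * g x}, g x ∂μ) := by
      simp only [ENNReal.tsum_mul_left]
    _ ≤ 4 ^ (j + 3) * κ * (2 * 4 ^ (j + 2) * ∫⁻ x, g x ^ (j + 3) ∂μ) := by
      gcongr _ * ?_
      exact mul_tsum_setLIntegral_le hg l j
    _ = _ := by ring

lemma le_two_mul_of_le_add_inv_two_mul {I X : ℝ≥0∞} (hI : I ≠ ⊤) (h : I ≤ X + 2⁻¹ * I) :
    I ≤ 2 * X := by
  refine (ENNReal.add_le_add_iff_right hI).1 ?_
  calc I + I = 2 * I := (two_mul I).symm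
    _ ≤ 2 * (X + 2⁻¹ * I) := by gcongr
    _ = 2 * X + I := by
      rw [mul_add, ENNReal.mul_inv_cancel_left two_ne_zero ENNReal.ofNat_ne_top]

lemma lintegral_pow_le_of_weak_estimate (hg : Measurable g) (hgtop : ∀ x, g x ≠ ⊤) (j : ℕ)
    (hfin : ∫⁻ x, g x ^ (j + 3) ∂μ ≠ ⊤) (hl : l ≠ 0) (hltop : l ≠ ⊤)
    (hκ : 2 * (4 ^ (2 * j + 5) * κ) ≤ 2⁻¹)
    (hweak : ∀ s, l ≤ s → s ≠ ⊤ →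
      s ^ 2 * μ {x | 2 * s < g x} ≤ κ * l * ∫⁻ x in {x | s < 4 * g x}, g x ∂μ) :
    ∫⁻ x, g x ^ (j + 3) ∂μ ≤ 2 * ((2 * l) ^ (j + 1) * ∫⁻ x, g x ^ 2 ∂μ) := by
  refine le_two_mul_of_le_add_inv_two_mul hfin
    ((lintegral_pow_le_add_tsum hg hgtop hl j).trans ?_)
  gcongr
  exact (tsum_mul_measure_le_of_weak_estimate hg hltop j hweak).trans (by gcongr)

end DyadicLevels

section Chebyshev

variable {α E : Type*} [MeasurableSpace α] {μ : Measure α} [NormedAddCommGroup E] {f : α → E}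
  {l : ℝ≥0∞}

lemma enorm_le_enorm_sub_add_enorm (a b : E) : ‖a‖ₑ ≤ ‖a - b‖ₑ + ‖b‖ₑ := by
  simpa only [edist_eq_enorm_sub, sub_zero] using edist_triangle a b 0

lemma mul_measure_lt_enorm_le_lintegral_sub (hf : AEStronglyMeasurable f μ) (hl : l ≠ ⊤) {c : E}
    (hc : ‖c‖ₑ ≤ l) : l * μ {y | 2 * l < ‖f y‖ₑ} ≤ ∫⁻ y, ‖f y - c‖ₑ ∂μ := by
  refine le_trans ?_ (mul_meas_ge_le_lintegral₀ (hf.sub aestronglyMeasurable_const).enorm l)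
  gcongr with y
  intro hy
  refine (ENNReal.add_le_add_iff_right hl).1 ?_
  calc l + l = 2 * l := (two_mul l).symm
    _ ≤ ‖f y‖ₑ := hy.le
    _ ≤ ‖f y - c‖ₑ + ‖c‖ₑ := enorm_le_enorm_sub_add_enorm _ _
    _ ≤ ‖f y - c‖ₑ + l := by gcongr

lemma mul_measure_univ_le_setLIntegral [IsFiniteMeasure μ] {g : α → ℝ≥0∞} (hg : Measurable g)
    (hl : l ≠ ⊤) (h : l * μ univ ≤ 2 * ∫⁻ y, g y ∂μ) :
    l * μ univ ≤ 4 * ∫⁻ y in {y | l < 4 * g y}, g y ∂μ := by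
  set P := {y | l < 4 * g y}
  have hP : MeasurableSet P := measurableSet_lt measurable_const (hg.const_mul 4)
  have hcompl : 4 * ∫⁻ y in Pᶜ, g y ∂μ ≤ l * μ univ := by
    rw [← lintegral_const_mul _ hg]
    calc ∫⁻ y in Pᶜ, 4 * g y ∂μ ≤ ∫⁻ _ in Pᶜ, l ∂μ :=
          setLIntegral_mono measurable_const fun y hy => not_lt.1 hy
      _ ≤ l * μ univ := by
          rw [setLIntegral_const]
          gcongr
          exact subset_univ _
  refine (ENNReal.add_le_add_iff_right (by finiteness : l * μ univ ≠ ⊤)).1 ?_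
  calc l * μ univ + l * μ univ = 2 * (l * μ univ) := (two_mul _).symm
    _ ≤ 2 * (2 * ∫⁻ y, g y ∂μ) := by gcongr
    _ = 4 * ∫⁻ y in P, g y ∂μ + 4 * ∫⁻ y in Pᶜ, g y ∂μ := by
        rw [← mul_add, lintegral_add_compl _ hP, ← mul_assoc]
        norm_num
    _ ≤ _ := by gcongr

lemma enorm_le_of_lintegral_le [IsFiniteMeasure μ] [NeZero μ] {c : E}
    (hf : AEStronglyMeasurable f μ)
    (havg : 2 * ∫⁻ y, ‖f y‖ₑ ∂μ ≤ l * μ univ)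
    (hosc : 2 * ∫⁻ y, ‖f y - c‖ₑ ∂μ ≤ l * μ univ) : ‖c‖ₑ ≤ l := by
  have hconst : ‖c‖ₑ * μ univ ≤ ∫⁻ y, ‖f y‖ₑ ∂μ + ∫⁻ y, ‖f y - c‖ₑ ∂μ := by
    rw [← lintegral_const, ← lintegral_add_left' hf.enorm]
    refine lintegral_mono fun y => ?_
    rw [add_comm, enorm_sub_rev]
    exact enorm_le_enorm_sub_add_enorm c (f y)
  have hdouble : 2 * (‖c‖ₑ * μ univ) ≤ 2 * (l * μ univ) :=
    calc 2 * (‖c‖ₑ * μ univ) ≤ 2 * (∫⁻ y, ‖f y‖ₑ ∂μ + ∫⁻ y, ‖f y - c‖ₑ ∂μ) := by gcongr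
      _ ≤ l * μ univ + l * μ univ := (mul_add _ _ _).trans_le (add_le_add havg hosc)
      _ = _ := (two_mul _).symm
  exact (ENNReal.mul_le_mul_iff_left (Measure.measure_univ_ne_zero.2 (NeZero.ne μ))
    (measure_ne_top μ univ)).1
    ((ENNReal.mul_le_mul_iff_right two_ne_zero ENNReal.ofNat_ne_top).1 hdouble)

end Chebyshev

section StoppingBall

variable {n : ℕ} {E : Type*} [NormedAddCommGroup E] {Ω : Set (Vec n)}
  {f : Vec n → E} {A : NNReal} {x : Vec n} {r ρ : ℝ} {d l : ℝ≥0∞}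

/-- A ball at which the averages of `‖f‖` over `ball x ρ ∩ Ω` first exceed `l / 2`, when the
radii decrease by factors of `10`: a Calderón–Zygmund stopping rule for the level `l`. -/
structure IsStoppingBall (Ω : Set (Vec n)) (f : Vec n → E) (l : ℝ≥0∞) (x : Vec n) (ρ : ℝ) :
    Prop where
  pos : 0 < ρ
  lt : l * volume (ball x ρ ∩ Ω) < 2 * ∫⁻ y in ball x ρ ∩ Ω, ‖f y‖ₑ
  le : 2 * ∫⁻ y in ball x (10 * ρ) ∩ Ω, ‖f y‖ₑ ≤ l * volume (ball x (10 * ρ) ∩ Ω)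

lemma measure_ball_inter_ne_zero (hΩ : IsOpen Ω) (hx : x ∈ Ω) (hρ : 0 < ρ) :
    volume (ball x ρ ∩ Ω) ≠ 0 :=
  ((isOpen_ball.inter hΩ).measure_pos volume ⟨x, mem_ball_self hρ, hx⟩).ne'

lemma measure_ball_inter_ne_top : volume (ball x ρ ∩ Ω) ≠ ⊤ :=
  measure_ne_top_of_subset inter_subset_left measure_ball_lt_top.ne

lemma eventually_mul_measure_lt_lintegral (hΩ : IsOpen Ω) (hf : Continuous f) (hl : l ≠ 0)
    (hlt : l ≠ ⊤) (hx : x ∈ Ω) (hfx : 2 * l < ‖f x‖ₑ) :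
    ∀ᶠ ρ in 𝓝[>] 0, l * volume (ball x ρ ∩ Ω) < 2 * ∫⁻ y in ball x ρ ∩ Ω, ‖f y‖ₑ := by
  have hnhds : {y | l < ‖f y‖ₑ} ∈ 𝓝 x := (isOpen_lt continuous_const hf.enorm).mem_nhds
    (lt_of_le_of_lt (le_mul_of_one_le_left' one_le_two) hfx)
  obtain ⟨η, hη, hsub⟩ := Metric.mem_nhds_iff.1 hnhds
  filter_upwards [Ioo_mem_nhdsGT hη] with ρ ⟨hρ, hρη⟩
  have hv0 := measure_ball_inter_ne_zero hΩ hx hρ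
  have hvt : volume (ball x ρ ∩ Ω) ≠ ⊤ := measure_ball_inter_ne_top
  calc l * volume (ball x ρ ∩ Ω) < 2 * (l * volume (ball x ρ ∩ Ω)) := by
        rw [two_mul]
        exact ENNReal.lt_add_right (by finiteness) (mul_ne_zero hl hv0)
    _ ≤ 2 * ∫⁻ y in ball x ρ ∩ Ω, ‖f y‖ₑ := by
        rw [← setLIntegral_const]
        gcongr 2 * ?_
        exact setLIntegral_mono hf.enorm.measurable fun y hy =>
          (hsub (ball_subset_ball hρη.le hy.1) : l < ‖f y‖ₑ).le

lemma exists_isStoppingBall (hΩ : IsOpen Ω) (hf : Continuous f) (hr : 0 < r) (hl : l ≠ 0)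
    (hlt : l ≠ ⊤) (hx : x ∈ Ω) (hfx : 2 * l < ‖f x‖ₑ)
    (hstart : 2 * ∫⁻ y in ball x r ∩ Ω, ‖f y‖ₑ ≤ l * volume (ball x r ∩ Ω)) :
    ∃ ρ, 10 * ρ ≤ r ∧ IsStoppingBall Ω f l x ρ := by
  have hlim : Tendsto (fun k : ℕ => r / 10 ^ k) atTop (𝓝[>] 0) :=
    tendsto_nhdsWithin_iff.2 ⟨tendsto_const_nhds.div_atTop
      (tendsto_pow_atTop_atTop_of_one_lt (by norm_num)), .of_forall fun k => by
        simpa using by positivity⟩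
  have hex := (hlim.eventually (eventually_mul_measure_lt_lintegral hΩ hf hl hlt hx hfx)).exists
  classical
  have hlarge := Nat.find_spec hex
  obtain ⟨i, hi⟩ := Nat.exists_eq_succ_of_ne_zero fun h : Nat.find hex = 0 => by
    rw [h, pow_zero, div_one] at hlarge
    exact hlarge.not_ge hstart
  have hmin := not_lt.1 (Nat.find_min hex (m := i) (by omega))
  rw [hi] at hlarge
  have hmul : 10 * (r / 10 ^ (i + 1)) = r / 10 ^ i := by
    rw [pow_succ]
    field_simp
  exact ⟨r / 10 ^ (i + 1), hmul.trans_le (div_le_self hr.le (one_le_pow₀ (by norm_num))),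
    by positivity, hlarge, by rwa [hmul]⟩

lemma exists_disjoint_isStoppingBall {Z : Set (Vec n)}
    (hZ : ∀ x ∈ Z, ∃ ρ, 10 * ρ ≤ r ∧ IsStoppingBall Ω f l x ρ) :
    ∃ u ⊆ Z, ∃ ρ : Vec n → ℝ, u.Countable ∧
      (∀ a ∈ u, 10 * ρ a ≤ r ∧ IsStoppingBall Ω f l a (ρ a)) ∧
      (u.PairwiseDisjoint fun a => ball a (ρ a)) ∧ Z ⊆ ⋃ a ∈ u, ball a (10 * ρ a) := by
  choose! ρ hρ using hZ
  obtain ⟨u, huZ, hdis, hcov⟩ := Vitali.exists_disjoint_subfamily_covering_enlargement_closedBall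
    Z id ρ r (fun a ha => by linarith [(hρ a ha).1, (hρ a ha).2.pos]) 5 (by norm_num)
  have hballs : u.PairwiseDisjoint fun a => ball a (ρ a) :=
    hdis.mono fun a => ball_subset_closedBall
  refine ⟨u, huZ, ρ, hballs.countable_of_isOpen (fun _ _ => isOpen_ball)
    fun a ha => ⟨a, mem_ball_self (hρ a (huZ ha)).2.pos⟩, fun a ha => hρ a (huZ ha), hballs,
    fun y hy => ?_⟩
  obtain ⟨a, ha, hsub⟩ := hcov y hy
  refine mem_iUnion₂.2 ⟨a, ha, ?_⟩
  exact closedBall_subset_ball (by linarith [(hρ a (huZ ha)).2.pos])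
    (hsub (mem_closedBall_self (hρ y hy).2.pos.le))

variable [NormedSpace ℝ E]

lemma IsStoppingBall.mul_measure_le (hS : IsStoppingBall Ω f l x ρ)
    (hΩ : IsOpen Ω) (hf : Continuous f) (hb : bmoSeminorm Ω f ≤ d) (hx : x ∈ Ω)
    (hlt : l ≠ ⊤) (hdl : 2 * A ^ 2 * d ≤ l) (hosc : HasOscillationBound E Ω A x (10 * ρ)) :
    l * volume (ball x (10 * ρ) ∩ Ω ∩ {y | 2 * l < ‖f y‖ₑ})
      ≤ A * d * volume (ball x (10 * ρ)) := by
  obtain ⟨c, hc⟩ := hosc.exists_lintegral_sub_le f hf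
  set B := ball x (10 * ρ) ∩ Ω
  have hcd : ∫⁻ y in B, ‖f y - c‖ₑ ≤ A * d * volume (ball x (10 * ρ)) := hc.trans (by gcongr)
  have : IsFiniteMeasure (volume.restrict B) := isFiniteMeasure_restrict.2 measure_ball_inter_ne_top
  have : NeZero (volume.restrict B) :=
    ⟨Measure.restrict_eq_zero.not.2 (measure_ball_inter_ne_zero hΩ hx (by linarith [hS.pos]))⟩
  have hcl : ‖c‖ₑ ≤ l := by
    refine enorm_le_of_lintegral_le (μ := volume.restrict B) hf.aestronglyMeasurable ?_ ?_
    · simpa only [Measure.restrict_apply_univ] using hS.le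
    · rw [Measure.restrict_apply_univ]
      calc 2 * ∫⁻ y in B, ‖f y - c‖ₑ ≤ 2 * (A * d * (A * volume B)) := by
            gcongr 2 * ?_
            exact hcd.trans (by gcongr; exact hosc.volume_le)
        _ = 2 * A ^ 2 * d * volume B := by ring
        _ ≤ _ := by gcongr
  have hmeas : MeasurableSet {y | 2 * l < ‖f y‖ₑ} :=
    measurableSet_lt measurable_const hf.enorm.measurable
  rw [inter_comm B, ← Measure.restrict_apply hmeas]
  exact (mul_measure_lt_enorm_le_lintegral_sub hf.aestronglyMeasurable hlt hcl).trans hcd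

lemma IsStoppingBall.sq_mul_measure_le (hS : IsStoppingBall Ω f l x ρ)
    (hΩ : IsOpen Ω) (hf : Continuous f) (hb : bmoSeminorm Ω f ≤ d) (hx : x ∈ Ω)
    (hlt : l ≠ ⊤) (hdl : 2 * A ^ 2 * d ≤ l)
    (hosc : HasOscillationBound E Ω A x (10 * ρ)) (hosc' : HasOscillationBound E Ω A x ρ) :
    l ^ 2 * volume (ball x (10 * ρ) ∩ Ω ∩ {y | 2 * l < ‖f y‖ₑ})
      ≤ 4 * A ^ 2 * 10 ^ n * d * ∫⁻ y in ball x ρ ∩ Ω ∩ {y | l < 4 * ‖f y‖ₑ}, ‖f y‖ₑ := by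
  have : IsFiniteMeasure (volume.restrict (ball x ρ ∩ Ω)) :=
    isFiniteMeasure_restrict.2 measure_ball_inter_ne_top
  have hlevel : MeasurableSet {y | l < 4 * ‖f y‖ₑ} :=
    measurableSet_lt measurable_const (hf.enorm.measurable.const_mul _)
  have hsmall : l * volume (ball x ρ ∩ Ω)
      ≤ 4 * ∫⁻ y in ball x ρ ∩ Ω ∩ {y | l < 4 * ‖f y‖ₑ}, ‖f y‖ₑ := by
    have := mul_measure_univ_le_setLIntegral (μ := volume.restrict (ball x ρ ∩ Ω))
      hf.enorm.measurable hlt (by simpa only [Measure.restrict_apply_univ] using hS.lt.le)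
    rwa [Measure.restrict_restrict hlevel, Measure.restrict_apply_univ, inter_comm {y | _}] at this
  have hdilate : volume (ball x (10 * ρ)) ≤ 10 ^ n * (A * volume (ball x ρ ∩ Ω)) := by
    rw [volume_ball_mul x x (by norm_num), ENNReal.ofReal_ofNat]
    gcongr
    exact hosc'.volume_le
  calc l ^ 2 * volume (ball x (10 * ρ) ∩ Ω ∩ {y | 2 * l < ‖f y‖ₑ})
      = l * (l * volume (ball x (10 * ρ) ∩ Ω ∩ {y | 2 * l < ‖f y‖ₑ})) := by ring
    _ ≤ l * (A * d * (10 ^ n * (A * volume (ball x ρ ∩ Ω)))) := by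
        gcongr l * ?_
        exact (hS.mul_measure_le hΩ hf hb hx hlt hdl hosc).trans (by gcongr)
    _ = A ^ 2 * 10 ^ n * d * (l * volume (ball x ρ ∩ Ω)) := by ring
    _ ≤ A ^ 2 * 10 ^ n * d * (4 * _) := by gcongr
    _ = _ := by ring

lemma sq_mul_measure_le (hΩ : IsOpen Ω) (hf : Continuous f) (hr : 0 < r)
    (hA : ∀ x ∈ Ω, ∀ ρ, 0 < ρ → ρ ≤ r → HasOscillationBound E Ω A x ρ)
    (hb : bmoSeminorm Ω f ≤ d) (hl : l ≠ 0) (hlt : l ≠ ⊤) (hdl : 2 * A ^ 2 * d ≤ l)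
    (hstart : ∀ x ∈ Ω, 2 * ∫⁻ y in ball x r ∩ Ω, ‖f y‖ₑ ≤ l * volume (ball x r ∩ Ω)) :
    l ^ 2 * volume (Ω ∩ {y | 2 * l < ‖f y‖ₑ})
      ≤ 4 * A ^ 2 * 10 ^ n * d * ∫⁻ y in Ω ∩ {y | l < 4 * ‖f y‖ₑ}, ‖f y‖ₑ := by
  set Z := Ω ∩ {y | 2 * l < ‖f y‖ₑ}
  set P := {y | l < 4 * ‖f y‖ₑ}
  have hPm : MeasurableSet P :=
    measurableSet_lt measurable_const (hf.enorm.measurable.const_mul _)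
  obtain ⟨u, huZ, ρ, hcount, hstopping, hdis, hcov⟩ := exists_disjoint_isStoppingBall
    fun x (hx : x ∈ Z) => exists_isStoppingBall hΩ hf hr hl hlt hx.1 hx.2 (hstart x hx.1)
  have hZcov : Z ⊆ ⋃ a ∈ u, ball a (10 * ρ a) ∩ Ω ∩ {y | 2 * l < ‖f y‖ₑ} := fun y hy => by
    obtain ⟨a, ha, hya⟩ := mem_iUnion₂.1 (hcov hy)
    exact mem_iUnion₂.2 ⟨a, ha, ⟨hya, hy.1⟩, hy.2⟩
  calc l ^ 2 * volume Z
      ≤ l ^ 2 * ∑' a : u, volume (ball (a : Vec n) (10 * ρ a) ∩ Ω ∩ {y | 2 * l < ‖f y‖ₑ}) := by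
        gcongr
        exact (measure_mono hZcov).trans (measure_biUnion_le volume hcount _)
    _ = ∑' a : u, l ^ 2 * volume (ball (a : Vec n) (10 * ρ a) ∩ Ω ∩ {y | 2 * l < ‖f y‖ₑ}) :=
        ENNReal.tsum_mul_left.symm
    _ ≤ ∑' a : u, 4 * A ^ 2 * 10 ^ n * d * ∫⁻ y in ball (a : Vec n) (ρ a) ∩ Ω ∩ P, ‖f y‖ₑ := by
        refine ENNReal.tsum_le_tsum fun a => ?_
        obtain ⟨hle, hS⟩ := hstopping a a.2
        have hpos := hS.pos
        have haΩ := (huZ a.2).1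
        exact hS.sq_mul_measure_le hΩ hf hb haΩ hlt hdl (hA a haΩ _ (by positivity) hle)
          (hA a haΩ _ hpos (by linarith))
    _ = 4 * A ^ 2 * 10 ^ n * d * ∫⁻ y in ⋃ a ∈ u, ball a (ρ a) ∩ Ω ∩ P, ‖f y‖ₑ := by
        rw [ENNReal.tsum_mul_left, lintegral_biUnion hcount
          (fun a _ => (measurableSet_ball.inter hΩ.measurableSet).inter hPm)]
        exact hdis.mono fun a => inter_subset_left.trans inter_subset_left
    _ ≤ _ := by
        gcongr
        exact iUnion₂_subset fun a _ y hy => ⟨hy.1.2, hy.2⟩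

end StoppingBall

section Interpolation

variable {n : ℕ} {E : Type*} [NormedAddCommGroup E] [NormedSpace ℝ E] {Ω : Set (Vec n)}
  {f : Vec n → E}

lemma eventually_mul_ofReal_le {K L : ℝ≥0∞} (hK : K ≠ ⊤) (hL : L ≠ 0) :
    ∀ᶠ δ in 𝓝[>] (0 : ℝ), K * ENNReal.ofReal δ ≤ L := by
  have hlim : Tendsto (fun δ : ℝ => K * ENNReal.ofReal δ) (𝓝[>] 0) (𝓝 (K * ENNReal.ofReal 0)) :=
    ENNReal.Tendsto.const_mul ((ENNReal.continuous_ofReal.tendsto 0).mono_left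
      nhdsWithin_le_nhds) (Or.inr hK)
  rw [ENNReal.ofReal_zero, mul_zero] at hlim
  exact (hlim.eventually (gt_mem_nhds hL.bot_lt)).mono fun _ => le_of_lt

lemma two_mul_lintegral_le_mul_measure_ball_inter {A C : NNReal} {r : ℝ} {d l : ℝ≥0∞} {x : Vec n}
    (hr : 0 < r) (hosc : HasOscillationBound E Ω A x r)
    (hbound : ∫⁻ y in Ω, ‖f y‖ₑ ≤ C * d)
    (hd : 2 * A * C * d ≤ l * volume (ball (0 : Vec n) r)) :
    2 * ∫⁻ y in ball x r ∩ Ω, ‖f y‖ₑ ≤ l * volume (ball x r ∩ Ω) := by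
  have hvol : volume (ball (0 : Vec n) r) ≤ A * volume (ball x r ∩ Ω) :=
    (Measure.addHaar_ball_center volume x r).symm.trans_le hosc.volume_le
  have hA : (A : ℝ≥0∞) ≠ 0 := left_ne_zero_of_mul
    ((measure_ball_pos volume (0 : Vec n) hr).trans_le hvol).ne'
  refine (ENNReal.mul_le_mul_iff_right hA ENNReal.coe_ne_top).1 ?_
  calc A * (2 * ∫⁻ y in ball x r ∩ Ω, ‖f y‖ₑ) ≤ A * (2 * (C * d)) := by
        gcongr A * (2 * ?_)
        exact (lintegral_mono_set inter_subset_right).trans hbound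
    _ = 2 * A * C * d := by ring
    _ ≤ l * (A * volume (ball x r ∩ Ω)) := hd.trans (by gcongr)
    _ = _ := mul_left_comm _ _ _

lemma two_mul_four_pow_mul_inv_le (j : ℕ) :
    2 * (4 ^ (2 * j + 5) * ((4 : ℝ≥0∞) ^ (2 * j + 6))⁻¹) ≤ 2⁻¹ := by
  rw [pow_succ 4 (2 * j + 5), ENNReal.mul_inv (by simp) (by simp), ← mul_assoc (4 ^ (2 * j + 5)),
    ENNReal.mul_inv_cancel (by simp) (by simp), one_mul, show (4 : ℝ≥0∞) = 2 * 2 by norm_num,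
    ENNReal.mul_inv (by simp) (by simp), ← mul_assoc, ENNReal.mul_inv_cancel (by simp) (by simp),
    one_mul]

lemma sq_mul_measure_restrict_le {A C : NNReal} {r : ℝ} {d l κ s : ℝ≥0∞} (hΩ : IsOpen Ω)
    (hf : Continuous f) (hr : 0 < r)
    (hA : ∀ x ∈ Ω, ∀ ρ, 0 < ρ → ρ ≤ r → HasOscillationBound E Ω A x ρ)
    (hb : bmoSeminorm Ω f ≤ d) (hbound : ∫⁻ x in Ω, ‖f x‖ₑ ≤ C * d) (hl : l ≠ 0)
    (hlevel : 2 * A ^ 2 * d ≤ l) (hstart : 2 * A * C * d ≤ l * volume (ball (0 : Vec n) r))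
    (hdecay : 4 * A ^ 2 * 10 ^ n * d ≤ κ * l) (hs : l ≤ s) (hst : s ≠ ⊤) :
    s ^ 2 * (volume.restrict Ω) {x | 2 * s < ‖f x‖ₑ}
      ≤ κ * l * ∫⁻ x in {x | s < 4 * ‖f x‖ₑ}, ‖f x‖ₑ ∂volume.restrict Ω := by
  rw [Measure.restrict_apply (measurableSet_lt measurable_const hf.enorm.measurable),
    Measure.restrict_restrict (measurableSet_lt measurable_const
      (hf.enorm.measurable.const_mul _)), inter_comm, inter_comm {x | s < 4 * ‖f x‖ₑ}]
  refine (sq_mul_measure_le hΩ hf hr hA hb ((hl.bot_lt.trans_le hs).ne') hst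
    (hlevel.trans hs) fun x hx => ?_).trans (by gcongr)
  exact two_mul_lintegral_le_mul_measure_ball_inter hr (hA x hx r hr le_rfl) hbound
    (hstart.trans (by gcongr))

theorem IsLipschitzDomain.exists_lintegral_pow_le_mul_lintegral_sq [CompleteSpace E]
    (hΩ : IsLipschitzDomain Ω) (j : ℕ) {ε : ℝ≥0∞} (hε : ε ≠ 0) :
    ∃ δ > 0, ∀ f : Vec n → E, Continuous f → MemLp f ∞ (volume.restrict Ω) →
      ∫ x in Ω, f x = 0 → bmoSeminorm Ω f ≤ ENNReal.ofReal δ →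
      ∫⁻ x in Ω, ‖f x‖ₑ ^ (j + 3) ≤ ε * ∫⁻ x in Ω, ‖f x‖ₑ ^ 2 := by
  obtain ⟨r, hr, A, hA⟩ := hΩ.exists_hasOscillationBound (E := E)
  obtain ⟨C, hC⟩ := hΩ.exists_lintegral_le_bmoSeminorm (E := E)
  set l : ℝ≥0∞ := min 2⁻¹ (ε / 4)
  have hl : l ≠ 0 := by simp [l, hε, ENNReal.div_eq_zero_iff]
  have hltop : l ≠ ⊤ := ne_top_of_le_ne_top (by simp) (min_le_left _ _)
  set κ : ℝ≥0∞ := (4 ^ (2 * j + 6))⁻¹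
  have hκl : κ * l ≠ 0 := mul_ne_zero (by simp [κ]) hl
  obtain ⟨δ, ⟨⟨hlevel, hstart⟩, hdecay⟩, hδ⟩ :=
    (((eventually_mul_ofReal_le (K := 2 * A ^ 2) (by finiteness) hl).and
      (eventually_mul_ofReal_le (K := 2 * A * C) (L := l * volume (ball (0 : Vec n) r))
        (by finiteness) (mul_ne_zero hl (measure_ball_pos _ _ hr).ne'))).and
      (eventually_mul_ofReal_le (K := 4 * A ^ 2 * 10 ^ n) (by finiteness) hκl)).and
      self_mem_nhdsWithin |>.exists
  refine ⟨δ, hδ, fun f hf hfmem hf0 hb => ?_⟩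
  have : IsFiniteMeasure (volume.restrict Ω) :=
    isFiniteMeasure_restrict.2 hΩ.bounded.measure_lt_top.ne
  have hbound : ∫⁻ x in Ω, ‖f x‖ₑ ≤ C * ENNReal.ofReal δ :=
    (hC f hf (hfmem.integrable le_top) hf0).trans (mul_le_mul_right hb _)
  have hfin : ∫⁻ x in Ω, ‖f x‖ₑ ^ (j + 3) ≠ ⊤ := by
    have hfpow := (hfmem.mono_exponent (p := (j + 3 : ℕ)) le_top).integrable_norm_pow'
    simpa [hasFiniteIntegral_iff_enorm, enorm_pow] using hfpow.2.ne
  refine (lintegral_pow_le_of_weak_estimate hf.enorm.measurable (fun x => enorm_ne_top) j hfin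
    hl hltop (two_mul_four_pow_mul_inv_le j) fun s hs hst =>
      sq_mul_measure_restrict_le hΩ.isOpen hf hr hA hb hbound hl hlevel hstart hdecay hs
        hst).trans ?_
  rw [← mul_assoc]
  gcongr
  calc 2 * (2 * l) ^ (j + 1) = 4 * l * (2 * l) ^ j := by ring
    _ ≤ 4 * (ε / 4) * 1 := by
      gcongr
      · exact min_le_right _ _
      · refine pow_le_one₀ zero_le ((mul_le_mul_right (min_le_left _ _) _).trans_eq ?_)
        exact ENNReal.mul_inv_cancel two_ne_zero ENNReal.ofNat_ne_top
    _ = ε := by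
      rw [mul_one, ENNReal.mul_div_cancel (by simp) (by simp)]

end Interpolation

section Taylor

variable {V W : Type*} [NormedAddCommGroup V] [NormedSpace ℝ V] [NormedAddCommGroup W]
  [NormedSpace ℝ W] {f : V → W} {z ξ : V} {a b C : ℝ}

/-- The remainder of the second order Taylor polynomial of `f` at `z`, in the increment `ξ`. -/
noncomputable def taylorRemainder (f : V → W) (z ξ : V) : W :=
  f (z + ξ) - f z - fderiv ℝ f z ξ - (1 / 2 : ℝ) • fderiv ℝ (fderiv ℝ f) z ξ ξ

lemma differentiable_fderiv_of_contDiff_two (hf : ContDiff ℝ 2 f) :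
    Differentiable ℝ (fderiv ℝ f) :=
  (hf.fderiv_right (m := 1) (by norm_num)).differentiable one_ne_zero

lemma norm_taylorRemainder_le :
    ‖taylorRemainder f z ξ‖ ≤ ‖f (z + ξ)‖ + ‖f z‖ + ‖fderiv ℝ f z ξ‖
      + ‖fderiv ℝ (fderiv ℝ f) z ξ ξ‖ := by
  have hhalf : ‖(1 / 2 : ℝ) • fderiv ℝ (fderiv ℝ f) z ξ ξ‖ ≤ ‖fderiv ℝ (fderiv ℝ f) z ξ ξ‖ := by
    rw [norm_smul]
    exact mul_le_of_le_one_left (norm_nonneg _) (by norm_num)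
  exact norm_sub_le_of_le (norm_sub_le_of_le (norm_sub_le _ _) le_rfl) hhalf

lemma norm_fderiv_add_smul_sub_le (hf : ContDiff ℝ 2 f)
    (hC : ∀ w ∈ closedBall z ‖ξ‖, ‖fderiv ℝ (fderiv ℝ f) w - fderiv ℝ (fderiv ℝ f) z‖ ≤ C)
    {t : ℝ} (ht : t ∈ Icc (0 : ℝ) 1) :
    ‖fderiv ℝ f (z + t • ξ) ξ - fderiv ℝ f z ξ - t • fderiv ℝ (fderiv ℝ f) z ξ ξ‖
      ≤ C * ‖ξ‖ ^ 2 := by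
  have hnorm : ‖t • ξ‖ ≤ ‖ξ‖ := by
    rw [norm_smul, Real.norm_of_nonneg ht.1]
    exact mul_le_of_le_one_left (norm_nonneg _) ht.2
  have hC0 : 0 ≤ C := (norm_nonneg (fderiv ℝ (fderiv ℝ f) z - _)).trans
    (hC z (mem_closedBall_self (norm_nonneg _)))
  have hmvt := (convex_closedBall z ‖ξ‖).norm_image_sub_le_of_norm_fderiv_le'
    (fun w _ => differentiable_fderiv_of_contDiff_two hf w) hC (mem_closedBall_self (norm_nonneg _))
    (y := z + t • ξ) (by simpa using hnorm)
  calc _ = ‖(fderiv ℝ f (z + t • ξ) - fderiv ℝ f z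
        - fderiv ℝ (fderiv ℝ f) z (z + t • ξ - z)) ξ‖ := by simp
    _ ≤ C * ‖z + t • ξ - z‖ * ‖ξ‖ := ContinuousLinearMap.le_of_opNorm_le _ hmvt ξ
    _ ≤ C * ‖ξ‖ * ‖ξ‖ := by
        rw [add_sub_cancel_left]
        gcongr
    _ = _ := by ring

lemma norm_taylorRemainder_le_mul_sq (hf : ContDiff ℝ 2 f)
    (hC : ∀ w ∈ closedBall z ‖ξ‖, ‖fderiv ℝ (fderiv ℝ f) w - fderiv ℝ (fderiv ℝ f) z‖ ≤ C) :
    ‖taylorRemainder f z ξ‖ ≤ C * ‖ξ‖ ^ 2 := by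
  set h := fderiv ℝ (fderiv ℝ f) z ξ ξ
  have hderiv (t : ℝ) : HasDerivAt
      (fun t : ℝ => f (z + t • ξ) - t • fderiv ℝ f z ξ - (t ^ 2 / 2) • h)
      (fderiv ℝ f (z + t • ξ) ξ - fderiv ℝ f z ξ - t • h) t := by
    have hline : HasDerivAt (fun t : ℝ => z + t • ξ) ξ t := by
      simpa using ((hasDerivAt_id t).smul_const ξ).const_add z
    have hcomp := (hf.differentiable two_ne_zero (z + t • ξ)).hasFDerivAt.comp_hasDerivAt t hline
    have hlin : HasDerivAt (fun t : ℝ => t • fderiv ℝ f z ξ) (fderiv ℝ f z ξ) t := by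
      simpa using (hasDerivAt_id t).smul_const (fderiv ℝ f z ξ)
    have hquad : HasDerivAt (fun t : ℝ => (t ^ 2 / 2) • h) (t • h) t := by
      simpa using ((hasDerivAt_pow 2 t).div_const 2).smul_const h
    exact (hcomp.sub hlin).sub hquad
  have hmvt := norm_image_sub_le_of_norm_deriv_le_segment_01'
    (fun t _ => (hderiv t).hasDerivWithinAt)
    fun t ht => norm_fderiv_add_smul_sub_le hf hC (Ico_subset_Icc_self ht)
  convert hmvt using 2
  simp only [taylorRemainder, one_smul, zero_smul, one_pow, add_zero, sub_zero, ne_eq,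
    OfNat.ofNat_ne_zero, not_false_eq_true, zero_pow, zero_div, h]
  abel

lemma norm_fderiv_le_of_norm_le (hf : ContDiff ℝ 2 f) (ha : ∀ w ∈ closedBall z 1, ‖f w‖ ≤ a)
    (hb : ∀ w ∈ closedBall z 1, ‖fderiv ℝ (fderiv ℝ f) w‖ ≤ b) :
    ‖fderiv ℝ f z‖ ≤ 2 * a + b := by
  have hz : z ∈ closedBall z 1 := mem_closedBall_self zero_le_one
  have ha0 : 0 ≤ a := (norm_nonneg _).trans (ha z hz)
  have hb0 : 0 ≤ b := (norm_nonneg (fderiv ℝ (fderiv ℝ f) z)).trans (hb z hz)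
  have hfderiv (w : V) (hw : w ∈ closedBall z 1) : ‖fderiv ℝ f w - fderiv ℝ f z‖ ≤ b := by
    refine ((convex_closedBall z 1).norm_image_sub_le_of_norm_fderiv_le
      (fun w _ => differentiable_fderiv_of_contDiff_two hf w) hb hz hw).trans ?_
    exact mul_le_of_le_one_right hb0 (by simpa [dist_eq_norm] using hw)
  refine ContinuousLinearMap.opNorm_le_of_unit_norm (by positivity) fun ξ hξ => ?_
  have hmem : z + ξ ∈ closedBall z 1 := by simp [hξ]
  have hlin := (convex_closedBall z 1).norm_image_sub_le_of_norm_fderiv_le'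
    (fun w _ => hf.differentiable two_ne_zero w) hfderiv hz hmem
  rw [add_sub_cancel_left, hξ, mul_one] at hlin
  calc ‖fderiv ℝ f z ξ‖ = ‖f (z + ξ) - f z - (f (z + ξ) - f z - fderiv ℝ f z ξ)‖ := by
        congr 1
        abel
    _ ≤ a + a + b := norm_sub_le_of_le (norm_sub_le_of_le (ha _ hmem) (ha z hz)) hlin
    _ = _ := by ring

end Taylor

section Integrand

variable {n N : ℕ} {Ω : Set (Vec n)} {F : Vec n → Mat N n → ℝ} {p : ℝ}

lemma HypReg.exists_norm_hessZ_le (hF : HypReg Ω F) (hΩ : Bornology.IsBounded Ω) (M : ℝ) :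
    ∃ B : ℝ, 0 ≤ B ∧ ∀ x ∈ closure Ω, ∀ z, ‖z‖ ≤ M → ‖hessZ F x z‖ ≤ B := by
  obtain ⟨B, hB⟩ := (hΩ.isCompact_closure.prod
    (isCompact_closedBall (0 : Mat N n) M)).exists_bound_of_continuousOn
      (f := fun q : Vec n × Mat N n => hessZ F q.1 q.2)
      (hF.continuous_hess.mono (prod_mono_right (subset_univ _)))
  exact ⟨max B 0, le_max_right _ _, fun x hx z hz =>
    (hB (x, z) ⟨hx, by simpa using hz⟩).trans (le_max_left _ _)⟩

lemma HypReg.exists_norm_hessZ_sub_le (hF : HypReg Ω F) (hΩ : Bornology.IsBounded Ω) (M : ℝ)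
    {ε : ℝ} (hε : 0 < ε) :
    ∃ η : ℝ, 0 < η ∧ η ≤ 1 ∧ ∀ x ∈ closure Ω, ∀ z w : Mat N n, ‖z‖ ≤ M →
      ‖w - z‖ ≤ η → ‖hessZ F x w - hessZ F x z‖ ≤ ε := by
  set H := fun q : Vec n × Mat N n => hessZ F q.1 q.2
  have huc : UniformContinuousOn H (closure Ω ×ˢ closedBall (0 : Mat N n) (M + 1)) :=
    (hΩ.isCompact_closure.prod (isCompact_closedBall _ _)).uniformContinuousOn_of_continuous
      (hF.continuous_hess.mono (prod_mono_right (subset_univ _)))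
  obtain ⟨δ, hδ, h⟩ := (Metric.uniformContinuousOn_iff (f := H)).1 huc ε hε
  refine ⟨min (δ / 2) 1, by positivity, min_le_right _ _, fun x hx z w hz hw => ?_⟩
  have hw1 : ‖w‖ ≤ M + 1 := by
    linarith [norm_le_norm_add_norm_sub' w z, hw.trans (min_le_right _ _)]
  have hdist : dist (x, w) (x, z) < δ := by
    rw [Prod.dist_eq, dist_self, dist_eq_norm, max_eq_right (norm_nonneg _)]
    linarith [hw.trans (min_le_left _ _)]
  have hH : dist (hessZ F x w) (hessZ F x z) < ε :=
    h (x, w) ⟨hx, by simpa using hw1⟩ (x, z) ⟨hx, by simpa using by linarith⟩ hdist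
  exact (dist_eq_norm (hessZ F x w) (hessZ F x z)).symm.le.trans hH.le

lemma HypGrowth.exists_abs_le (hF : HypGrowth Ω p F) (hp : 0 ≤ p) {M : ℝ} (hM : 0 ≤ M) {q : ℕ}
    (hpq : p ≤ q) :
    ∃ D > 0, ∀ x ∈ closure Ω, ∀ (z : Mat N n) (t : ℝ), 1 ≤ t → ‖z‖ ≤ M * t →
      |F x z| ≤ D * t ^ q := by
  obtain ⟨c, hc, hF⟩ := hF
  refine ⟨c * (1 + M ^ p), by positivity, fun x hx z t ht hz => (hF x hx z).trans ?_⟩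
  have htpq : t ^ p ≤ t ^ q := by
    rw [← Real.rpow_natCast]
    exact Real.rpow_le_rpow_of_exponent_le ht hpq
  calc c * (1 + ‖z‖ ^ p) ≤ c * (t ^ q + M ^ p * t ^ q) := by
        gcongr
        · exact one_le_pow₀ ht
        · calc ‖z‖ ^ p ≤ (M * t) ^ p := by gcongr
            _ = M ^ p * t ^ p := Real.mul_rpow hM (by linarith)
            _ ≤ _ := by gcongr
    _ = _ := by ring

lemma exists_norm_fderiv_le (hΩ : Bornology.IsBounded Ω) (hp : 0 ≤ p) (hF0 : HypReg Ω F)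
    (hF1 : HypGrowth Ω p F) {M : ℝ} (hM : 0 ≤ M) :
    ∃ B : ℝ, 0 ≤ B ∧ ∀ x ∈ closure Ω, ∀ z, ‖z‖ ≤ M → ‖fderiv ℝ (F x) z‖ ≤ B := by
  obtain ⟨B, hB0, hB⟩ := hF0.exists_norm_hessZ_le hΩ (M + 1)
  obtain ⟨D, hD0, hD⟩ := hF1.exists_abs_le hp (by linarith : 0 ≤ M + 1) (Nat.le_ceil p)
  refine ⟨2 * D + B, by positivity, fun x hx z hz => ?_⟩
  have hball (w : Mat N n) (hw : w ∈ closedBall z 1) : ‖w‖ ≤ M + 1 := by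
    rw [mem_closedBall, dist_eq_norm] at hw
    linarith [norm_le_norm_add_norm_sub' w z]
  exact norm_fderiv_le_of_norm_le (hF0.contDiff x hx)
    (fun w hw => by simpa using hD x hx w 1 le_rfl (by simpa using hball w hw))
    fun w hw => hB x hx w (hball w hw)

lemma exists_taylorRemainder_le_mul_pow (hΩ : Bornology.IsBounded Ω) (hp : 0 ≤ p)
    (hF0 : HypReg Ω F) (hF1 : HypGrowth Ω p F) {M : ℝ} (hM : 0 ≤ M) {q : ℕ} (hq : 2 ≤ q)
    (hpq : p ≤ q) :
    ∃ D > 0, ∀ x ∈ closure Ω, ∀ (z ξ : Mat N n) (t : ℝ), ‖z‖ ≤ M → 1 ≤ t → ‖ξ‖ ≤ t →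
      ‖taylorRemainder (F x) z ξ‖ ≤ D * t ^ q := by
  obtain ⟨B, hB0, hB⟩ := hF0.exists_norm_hessZ_le hΩ M
  obtain ⟨B', hB'0, hB'⟩ := exists_norm_fderiv_le hΩ hp hF0 hF1 hM
  obtain ⟨D, hD0, hD⟩ := hF1.exists_abs_le hp (by linarith : 0 ≤ M + 1) hpq
  refine ⟨D + D + B' + B, by positivity, fun x hx z ξ t hz ht hξ => ?_⟩
  have hMt : M ≤ M * t := le_mul_of_one_le_right hM ht
  have hsum : ‖F x (z + ξ)‖ ≤ D * t ^ q :=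
    hD x hx _ t ht ((norm_add_le z ξ).trans (by linarith))
  have hbase : ‖F x z‖ ≤ D * t ^ q := hD x hx z t ht (by linarith)
  have hfst : ‖fderiv ℝ (F x) z ξ‖ ≤ B' * t ^ q := by
    refine (ContinuousLinearMap.le_of_opNorm_le _ (hB' x hx z hz) ξ).trans ?_
    gcongr
    exact hξ.trans (le_self_pow₀ ht (by omega))
  have hsnd : ‖fderiv ℝ (fderiv ℝ (F x)) z ξ ξ‖ ≤ B * t ^ q := by
    calc _ ≤ ‖hessZ F x z‖ * ‖ξ‖ * ‖ξ‖ := (hessZ F x z).le_opNorm₂ ξ ξ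
      _ ≤ B * t * t := by
          gcongr
          exact hB x hx z hz
      _ = B * t ^ 2 := by ring
      _ ≤ B * t ^ q := by gcongr
  calc _ ≤ D * t ^ q + D * t ^ q + B' * t ^ q + B * t ^ q :=
        norm_taylorRemainder_le.trans (by gcongr)
    _ = _ := by ring

lemma exists_taylorRemainder_le_sq_add_pow (hΩ : Bornology.IsBounded Ω) (hp : 0 ≤ p)
    (hF0 : HypReg Ω F) (hF1 : HypGrowth Ω p F) {M : ℝ} (hM : 0 ≤ M) {q : ℕ} (hq : 2 ≤ q)
    (hpq : p ≤ q) {ε : ℝ} (hε : 0 < ε) :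
    ∃ C > 0, ∀ x ∈ closure Ω, ∀ z ξ : Mat N n, ‖z‖ ≤ M →
      ‖taylorRemainder (F x) z ξ‖ ≤ ε * ‖ξ‖ ^ 2 + C * ‖ξ‖ ^ q := by
  obtain ⟨η, hη0, hη1, hη⟩ := hF0.exists_norm_hessZ_sub_le hΩ M hε
  obtain ⟨D, hD0, hD⟩ := exists_taylorRemainder_le_mul_pow hΩ hp hF0 hF1 hM hq hpq
  refine ⟨D / η ^ q, by positivity, fun x hx z ξ hz => ?_⟩
  rcases le_or_gt ‖ξ‖ η with hξ | hξ
  · refine le_add_of_le_of_nonneg ?_ (by positivity)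
    refine norm_taylorRemainder_le_mul_sq (hF0.contDiff x hx) fun w hw => ?_
    rw [mem_closedBall, dist_eq_norm] at hw
    exact hη x hx z w hz (hw.trans hξ)
  · refine le_add_of_nonneg_of_le (by positivity) ?_
    refine (hD x hx z ξ (‖ξ‖ / η) hz ((one_le_div₀ hη0).2 hξ.le)
      (le_div_self (norm_nonneg _) hη0 hη1)).trans_eq ?_
    rw [div_pow]
    ring

end Integrand

section Measurability

variable {α V W : Type*} [MeasurableSpace α] {μ : Measure α} [NormedAddCommGroup W]
  {F : α → V → W} {v ξ : α → V}

lemma aestronglyMeasurable_comp_simpleFunc (hm : ∀ z, AEStronglyMeasurable (fun x => F x z) μ)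
    (s : SimpleFunc α V) : AEStronglyMeasurable (fun x => F x (s x)) μ := by
  classical
  have hsum : (fun x => F x (s x))
      = fun x => ∑ z ∈ s.range, (s ⁻¹' {z}).indicator (fun x => F x z) x := by
    ext x
    have hne : ∀ z ∈ s.range, z ≠ s x → (s ⁻¹' {z}).indicator (fun x => F x z) x = 0 :=
      fun z _ hz => indicator_of_notMem (fun h : s x = z => hz h.symm) _
    rw [Finset.sum_eq_single_of_mem (s x) (s.mem_range_self x) hne,
      indicator_of_mem (show x ∈ s ⁻¹' {s x} from rfl)]
  rw [hsum]
  exact Finset.aestronglyMeasurable_fun_sum _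
    fun z _ => (hm z).indicator (s.measurableSet_fiber z)

variable [NormedAddCommGroup V]

lemma aestronglyMeasurable_comp_of_continuous
    (hm : ∀ z, AEStronglyMeasurable (fun x => F x z) μ) (hc : ∀ᵐ x ∂μ, Continuous (F x))
    (hv : AEStronglyMeasurable v μ) :
    AEStronglyMeasurable (fun x => F x (v x)) μ := by
  have hmk := hv.stronglyMeasurable_mk
  have hFmk : AEStronglyMeasurable (fun x => F x (hv.mk v x)) μ := by
    refine aestronglyMeasurable_of_tendsto_ae atTop
      (fun k => aestronglyMeasurable_comp_simpleFunc hm (hmk.approx k)) ?_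
    filter_upwards [hc] with x hx
    exact (hx.tendsto _).comp (hmk.tendsto_approx x)
  refine hFmk.congr ?_
  filter_upwards [hv.ae_eq_mk] with x hx
  rw [← hx]

variable [NormedSpace ℝ V] [NormedSpace ℝ W]

lemma aestronglyMeasurable_fderiv_comp
    (hm : ∀ z, AEStronglyMeasurable (fun x => F x z) μ) (hd : ∀ᵐ x ∂μ, Differentiable ℝ (F x))
    (hv : AEStronglyMeasurable v μ) (hξ : AEStronglyMeasurable ξ μ) :
    AEStronglyMeasurable (fun x => fderiv ℝ (F x) (v x) (ξ x)) μ := by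
  have hcomp {w : α → V} (hw : AEStronglyMeasurable w μ) :
      AEStronglyMeasurable (fun x => F x (w x)) μ :=
    aestronglyMeasurable_comp_of_continuous hm (hd.mono fun x h => h.continuous) hw
  refine aestronglyMeasurable_of_tendsto_ae (u := atTop) (f := fun (k : ℕ) x =>
    ((k : ℝ) + 1) • (F x (v x + ((k : ℝ) + 1)⁻¹ • ξ x) - F x (v x))) (fun k => ?_) ?_
  · exact ((hcomp (hv.add (hξ.const_smul _))).sub (hcomp hv)).const_smul ((k : ℝ) + 1)
  · filter_upwards [hd] with x hx
    exact (hx (v x)).hasFDerivAt.lim (ξ x) (tendsto_norm_atTop_atTop.comp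
      (tendsto_atTop_add_const_right _ _ tendsto_natCast_atTop_atTop))

lemma aestronglyMeasurable_fderiv_fderiv_comp
    (hm : ∀ z, AEStronglyMeasurable (fun x => F x z) μ) (hc : ∀ᵐ x ∂μ, ContDiff ℝ 2 (F x))
    (hv : AEStronglyMeasurable v μ) (hξ : AEStronglyMeasurable ξ μ) :
    AEStronglyMeasurable (fun x => fderiv ℝ (fderiv ℝ (F x)) (v x) (ξ x) (ξ x)) μ := by
  have hd : ∀ᵐ x ∂μ, Differentiable ℝ (F x) := hc.mono fun x h => h.differentiable two_ne_zero
  have hd' : ∀ᵐ x ∂μ, Differentiable ℝ fun z => fderiv ℝ (F x) z (ξ x) :=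
    hc.mono fun x h => (differentiable_fderiv_of_contDiff_two h).clm_apply
      (differentiable_const _)
  refine (aestronglyMeasurable_fderiv_comp (F := fun x z => fderiv ℝ (F x) z (ξ x))
    (fun z => aestronglyMeasurable_fderiv_comp hm hd aestronglyMeasurable_const hξ)
    hd' hv hξ).congr ?_
  filter_upwards [hc] with x hx
  rw [fderiv_clm_apply (differentiable_fderiv_of_contDiff_two hx _) (differentiableAt_const _)]
  simp

end Measurability

section Gradient

variable {n N : ℕ} {Ω : Set (Vec n)} {φ : Vec n → Vec N}

lemma IsTestMap.continuous_grad (h : IsTestMap Ω φ) : Continuous (grad φ) := by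
  have hfderiv : Continuous (fderiv ℝ φ) := h.smooth.continuous_fderiv (by simp)
  exact (PiLp.continuous_toLp 2 _).comp (continuous_pi fun ij =>
    (EuclideanSpace.proj ij.1).continuous.comp (hfderiv.clm_apply continuous_const))

lemma support_grad_subset : Function.support (grad φ) ⊆ Function.support (fderiv ℝ φ) := by
  refine fun x hx h0 => hx ?_
  ext ij
  simp [grad, h0]

lemma IsTestMap.hasCompactSupport_grad (h : IsTestMap Ω φ) : HasCompactSupport (grad φ) :=
  (h.compact.fderiv (𝕜 := ℝ)).mono support_grad_subset

lemma IsTestMap.memLp_grad (h : IsTestMap Ω φ) : MemLp (grad φ) ∞ (volume.restrict Ω) :=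
  (h.continuous_grad.memLp_top_of_hasCompactSupport h.hasCompactSupport_grad volume).restrict Ω

lemma IsTestMap.setIntegral_grad (h : IsTestMap Ω φ) :
    ∫ x in Ω, grad φ x = ∫ x, grad φ x :=
  setIntegral_eq_integral_of_forall_compl_eq_zero fun _ hx => by_contra fun h0 =>
    hx (h.subset (support_fderiv_subset ℝ (support_grad_subset h0)))

lemma integrable_fderiv_apply {E G : Type*} [NormedAddCommGroup E] [NormedSpace ℝ E]
    [MeasurableSpace E] [OpensMeasurableSpace E] {μ : Measure E} [IsFiniteMeasureOnCompacts μ]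
    [NormedAddCommGroup G] [NormedSpace ℝ G] {f : E → G} (hf : ContDiff ℝ 1 f)
    (hfs : HasCompactSupport f) (v : E) : Integrable (fun x => fderiv ℝ f x v) μ := by
  have hfderiv : Continuous (fderiv ℝ f) := hf.continuous_fderiv one_ne_zero
  refine (hfderiv.clm_apply continuous_const).integrable_of_hasCompactSupport ?_
  exact (hfs.fderiv (𝕜 := ℝ)).comp_left (g := fun T : E →L[ℝ] G => T v) rfl

lemma integral_fderiv_apply_eq_zero {E G : Type*} [NormedAddCommGroup E] [NormedSpace ℝ E]
    [FiniteDimensional ℝ E] [MeasurableSpace E] [BorelSpace E] {μ : Measure E}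
    [μ.IsAddHaarMeasure] [NormedAddCommGroup G] [NormedSpace ℝ G] {f : E → G}
    (hf : ContDiff ℝ 1 f) (hfs : HasCompactSupport f) (v : E) :
    ∫ x, fderiv ℝ f x v ∂μ = 0 := by
  have hparts := integral_smul_fderiv_eq_neg_fderiv_smul_of_integrable (𝕜 := ℝ) (μ := μ)
    (f := fun _ : E => (1 : ℝ)) (g := f) (v := v) (by simp)
    (by simpa using integrable_fderiv_apply hf hfs v)
    (by simpa using hf.continuous.integrable_of_hasCompactSupport hfs) (by fun_prop)
    (fun x _ => hf.differentiable one_ne_zero x)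
  simpa using hparts

lemma IsTestMap.integral_grad (h : IsTestMap Ω φ) : ∫ x in Ω, grad φ x = 0 := by
  have hφ : ContDiff ℝ 1 φ := h.smooth.of_le (by simp)
  rw [h.setIntegral_grad]
  ext ij
  have hgrad := (EuclideanSpace.proj (𝕜 := ℝ) ij).integral_comp_comm
    (h.continuous_grad.integrable_of_hasCompactSupport (μ := volume) h.hasCompactSupport_grad)
  have hpartial := (EuclideanSpace.proj (𝕜 := ℝ) ij.1).integral_comp_comm
    (integrable_fderiv_apply (μ := volume) hφ h.compact (EuclideanSpace.single ij.2 1))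
  rw [integral_fderiv_apply_eq_zero hφ h.compact, map_zero] at hpartial
  exact hgrad.symm.trans hpartial

end Gradient

section Energy

lemma integral_taylorRemainder {α V W : Type*} [MeasurableSpace α] {μ : Measure α}
    [NormedAddCommGroup V] [NormedSpace ℝ V] [NormedAddCommGroup W] [NormedSpace ℝ W]
    {F : α → V → W} {v w : α → V} (h₀ : Integrable (fun x => F x (v x)) μ)
    (h₁ : Integrable (fun x => fderiv ℝ (F x) (v x) (w x)) μ)
    (h₂ : Integrable (fun x => fderiv ℝ (fderiv ℝ (F x)) (v x) (w x) (w x)) μ)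
    (hadd : Integrable (fun x => F x (v x + w x)) μ) :
    ∫ x, taylorRemainder (F x) (v x) (w x) ∂μ
      = ∫ x, F x (v x + w x) ∂μ - ∫ x, F x (v x) ∂μ - ∫ x, fderiv ℝ (F x) (v x) (w x) ∂μ
        - (1 / 2 : ℝ) • ∫ x, fderiv ℝ (fderiv ℝ (F x)) (v x) (w x) (w x) ∂μ := by
  simp only [taylorRemainder]
  have hsub : Integrable (fun x => F x (v x + w x) - F x (v x)) μ := hadd.sub h₀
  have hsub' : Integrable (fun x => F x (v x + w x) - F x (v x) - fderiv ℝ (F x) (v x) (w x)) μ :=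
    hsub.sub h₁
  rw [integral_sub hsub' (h₂.fun_smul _), integral_sub hsub h₁, integral_sub hadd h₀,
    integral_smul]

lemma integral_le_integral_add_of_taylorRemainder_le {α V : Type*} [MeasurableSpace α]
    {μ : Measure α} [NormedAddCommGroup V] [NormedSpace ℝ V] {F : α → V → ℝ} {v w : α → V}
    {c C : ℝ} {q : ℕ} (h₀ : Integrable (fun x => F x (v x)) μ)
    (h₁ : Integrable (fun x => fderiv ℝ (F x) (v x) (w x)) μ)
    (h₂ : Integrable (fun x => fderiv ℝ (fderiv ℝ (F x)) (v x) (w x) (w x)) μ)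
    (hadd : Integrable (fun x => F x (v x + w x)) μ)
    (hsq : Integrable (fun x => ‖w x‖ ^ 2) μ) (hpow : Integrable (fun x => ‖w x‖ ^ q) μ)
    (hR : ∀ᵐ x ∂μ, ‖taylorRemainder (F x) (v x) (w x)‖ ≤ c / 4 * ‖w x‖ ^ 2 + C * ‖w x‖ ^ q)
    (hfirst : ∫ x, fderiv ℝ (F x) (v x) (w x) ∂μ = 0)
    (hsecond : c * ∫ x, ‖w x‖ ^ 2 ∂μ ≤ ∫ x, fderiv ℝ (fderiv ℝ (F x)) (v x) (w x) (w x) ∂μ)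
    (hinterp : C * ∫ x, ‖w x‖ ^ q ∂μ ≤ c / 4 * ∫ x, ‖w x‖ ^ 2 ∂μ) :
    ∫ x, F x (v x) ∂μ ≤ ∫ x, F x (v x + w x) ∂μ := by
  have hbound := norm_integral_le_of_norm_le ((hsq.const_mul (c / 4)).add (hpow.const_mul C)) hR
  simp only [Pi.add_apply] at hbound
  rw [integral_taylorRemainder h₀ h₁ h₂ hadd, hfirst, Real.norm_eq_abs, smul_eq_mul,
    integral_add (hsq.const_mul _) (hpow.const_mul _), integral_const_mul,
    integral_const_mul] at hbound
  linarith [(abs_le.1 hbound).1]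

variable {n N : ℕ} {Ω : Set (Vec n)} {F : Vec n → Mat N n → ℝ} {p : ℝ} {v w : Vec n → Mat N n}

lemma ae_restrict_mem_closure : ∀ᵐ x ∂volume.restrict Ω, x ∈ closure Ω :=
  ae_restrict_of_ae_restrict_of_subset subset_closure
    (ae_restrict_mem isClosed_closure.measurableSet)

lemma isFiniteMeasure_restrict_of_isBounded (hΩ : Bornology.IsBounded Ω) :
    IsFiniteMeasure (volume.restrict Ω) :=
  isFiniteMeasure_restrict.2 hΩ.measure_lt_top.ne

lemma HypReg.integrable_comp (hF0 : HypReg Ω F) (hF1 : HypGrowth Ω p F)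
    (hΩ : Bornology.IsBounded Ω) (hp : 0 ≤ p) (hv : MemLp v ∞ (volume.restrict Ω)) :
    Integrable (fun x => F x (v x)) (volume.restrict Ω) := by
  have := isFiniteMeasure_restrict_of_isBounded hΩ
  obtain ⟨c, hc, hF1⟩ := hF1
  have hcont : ∀ᵐ x ∂volume.restrict Ω, Continuous (F x) :=
    ae_restrict_mem_closure.mono fun x hx => (hF0.contDiff x hx).continuous
  refine Integrable.of_bound
    (aestronglyMeasurable_comp_of_continuous hF0.measurable hcont hv.aestronglyMeasurable)
    (c * (1 + lpNorm v ∞ (volume.restrict Ω) ^ p)) ?_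
  filter_upwards [ae_le_lpNorm_exponent_top hv, ae_restrict_mem_closure] with x hx hxΩ
  exact (hF1 x hxΩ _).trans (by gcongr)

lemma HypReg.integrable_fderiv_comp (hF0 : HypReg Ω F) (hF1 : HypGrowth Ω p F)
    (hΩ : Bornology.IsBounded Ω) (hp : 0 ≤ p) (hv : MemLp v ∞ (volume.restrict Ω))
    (hw : MemLp w ∞ (volume.restrict Ω)) :
    Integrable (fun x => fderiv ℝ (F x) (v x) (w x)) (volume.restrict Ω) := by
  have := isFiniteMeasure_restrict_of_isBounded hΩ
  obtain ⟨B, -, hB⟩ := exists_norm_fderiv_le hΩ hp hF0 hF1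
    (lpNorm_nonneg (f := v) (p := ∞) (μ := volume.restrict Ω))
  have hdiff : ∀ᵐ x ∂volume.restrict Ω, Differentiable ℝ (F x) :=
    ae_restrict_mem_closure.mono fun x hx => (hF0.contDiff x hx).differentiable two_ne_zero
  refine Integrable.of_bound (aestronglyMeasurable_fderiv_comp hF0.measurable hdiff
    hv.aestronglyMeasurable hw.aestronglyMeasurable) (B * lpNorm w ∞ (volume.restrict Ω)) ?_
  filter_upwards [ae_le_lpNorm_exponent_top hv, ae_le_lpNorm_exponent_top hw,
    ae_restrict_mem_closure] with x hvx hwx hx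
  exact (fderiv ℝ (F x) (v x)).le_of_opNorm_le_of_le (hB x hx _ hvx) hwx

lemma HypReg.integrable_hessZ_comp (hF : HypReg Ω F) (hΩ : Bornology.IsBounded Ω)
    (hv : MemLp v ∞ (volume.restrict Ω)) (hw : MemLp w ∞ (volume.restrict Ω)) :
    Integrable (fun x => hessZ F x (v x) (w x) (w x)) (volume.restrict Ω) := by
  have := isFiniteMeasure_restrict_of_isBounded hΩ
  set L : ℝ := lpNorm w ∞ (volume.restrict Ω)
  obtain ⟨B, hB0, hB⟩ := hF.exists_norm_hessZ_le hΩ (lpNorm v ∞ (volume.restrict Ω))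
  have hC2 : ∀ᵐ x ∂volume.restrict Ω, ContDiff ℝ 2 (F x) :=
    ae_restrict_mem_closure.mono hF.contDiff
  refine Integrable.of_bound (aestronglyMeasurable_fderiv_fderiv_comp hF.measurable hC2
    hv.aestronglyMeasurable hw.aestronglyMeasurable) (B * L * L) ?_
  filter_upwards [ae_le_lpNorm_exponent_top hv, ae_le_lpNorm_exponent_top hw,
    ae_restrict_mem_closure] with x hvx hwx hx
  have hL : 0 ≤ L := lpNorm_nonneg
  have hBx : ‖hessZ F x (v x)‖ ≤ B := hB x hx _ hvx
  exact ((hessZ F x (v x)).le_opNorm₂ _ _).trans (by gcongr)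

lemma integrable_norm_pow_of_memLp_top {α E : Type*} [MeasurableSpace α] {μ : Measure α}
    [IsFiniteMeasure μ] [NormedAddCommGroup E] {f : α → E} (hf : MemLp f ∞ μ) (q : ℕ) :
    Integrable (fun x => ‖f x‖ ^ q) μ :=
  (hf.mono_exponent (p := q) le_top).integrable_norm_pow'

lemma lintegral_enorm_pow_eq_ofReal {α E : Type*} [MeasurableSpace α] {μ : Measure α}
    [NormedAddCommGroup E] {f : α → E} {q : ℕ} (hf : Integrable (fun x => ‖f x‖ ^ q) μ) :
    ∫⁻ x, ‖f x‖ₑ ^ q ∂μ = ENNReal.ofReal (∫ x, ‖f x‖ ^ q ∂μ) := by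
  rw [ofReal_integral_eq_lintegral_ofReal hf (ae_of_all _ fun x => by positivity)]
  exact lintegral_congr fun x => by rw [ENNReal.ofReal_pow (norm_nonneg _), ofReal_norm]

lemma IsLipschitzDomain.exists_integral_pow_le_mul_integral_sq {E : Type*}
    [NormedAddCommGroup E] [NormedSpace ℝ E] [CompleteSpace E] (hΩ : IsLipschitzDomain Ω)
    (j : ℕ) {ε : ℝ} (hε : 0 < ε) :
    ∃ δ > 0, ∀ f : Vec n → E, Continuous f → MemLp f ∞ (volume.restrict Ω) →
      ∫ x in Ω, f x = 0 → bmoSeminorm Ω f ≤ ENNReal.ofReal δ →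
      ∫ x in Ω, ‖f x‖ ^ (j + 3) ≤ ε * ∫ x in Ω, ‖f x‖ ^ 2 := by
  have := isFiniteMeasure_restrict_of_isBounded hΩ.bounded
  obtain ⟨δ, hδ, h⟩ := hΩ.exists_lintegral_pow_le_mul_lintegral_sq (E := E) j
    (ENNReal.ofReal_pos.2 hε).ne'
  refine ⟨δ, hδ, fun f hf hfmem hf0 hb => ?_⟩
  have hle := h f hf hfmem hf0 hb
  rw [lintegral_enorm_pow_eq_ofReal (integrable_norm_pow_of_memLp_top hfmem _),
    lintegral_enorm_pow_eq_ofReal (integrable_norm_pow_of_memLp_top hfmem _),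
    ← ENNReal.ofReal_mul hε.le] at hle
  exact (ENNReal.ofReal_le_ofReal_iff (by positivity)).1 hle

end Energy

theorem theorem4p3_general {n N : ℕ} {Ω : Set (Vec n)} (hΩ : IsLipschitzDomain Ω)
    {p : ℝ} (hp : 0 ≤ p) {F : Vec n → Mat N n → ℝ} (hF0 : HypReg Ω F) (hF1 : HypGrowth Ω p F)
    {G : Vec n → Mat N n} (hG : MemLp G ∞ (volume.restrict Ω))
    (hext : ∀ φ : Vec n → Vec N, IsTestMap Ω φ →
      ∫ x in Ω, fderiv ℝ (F x) (G x) (grad φ x) = 0)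
    {c₃ : ℝ} (hc₃ : 0 < c₃)
    (hsec : ∀ φ : Vec n → Vec N, IsTestMap Ω φ →
      c₃ * ∫ x in Ω, ‖grad φ x‖ ^ 2 ≤ ∫ x in Ω, hessZ F x (G x) (grad φ x) (grad φ x)) :
    ∃ δ : ℝ, 0 < δ ∧ ∀ φ : Vec n → Vec N, IsTestMap Ω φ →
      bmoSeminorm Ω (grad φ) ≤ ENNReal.ofReal δ →
        ∫ x in Ω, F x (G x) ≤ ∫ x in Ω, F x (G x + grad φ x) := by
  have := isFiniteMeasure_restrict_of_isBounded hΩ.bounded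
  have hpq : p ≤ (⌈p⌉₊ + 3 : ℕ) := (Nat.le_ceil p).trans (by norm_num)
  obtain ⟨C, hC0, hC⟩ := exists_taylorRemainder_le_sq_add_pow hΩ.bounded hp hF0 hF1
    (lpNorm_nonneg (f := G) (p := ∞) (μ := volume.restrict Ω)) (by omega) hpq
    (show 0 < c₃ / 4 by positivity)
  obtain ⟨δ, hδ, hinterp⟩ := hΩ.exists_integral_pow_le_mul_integral_sq (E := Mat N n) ⌈p⌉₊
    (show 0 < c₃ / 4 / C by positivity)
  refine ⟨δ, hδ, fun φ hφ hbmo => ?_⟩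
  have hgrad := hφ.memLp_grad
  have hpow := hinterp (grad φ) hφ.continuous_grad hgrad hφ.integral_grad hbmo
  have hR : ∀ᵐ x ∂volume.restrict Ω, ‖taylorRemainder (F x) (G x) (grad φ x)‖
      ≤ c₃ / 4 * ‖grad φ x‖ ^ 2 + C * ‖grad φ x‖ ^ (⌈p⌉₊ + 3) := by
    filter_upwards [ae_le_lpNorm_exponent_top hG, ae_restrict_mem_closure] with x hx hxΩ
    exact hC x hxΩ _ _ hx
  refine integral_le_integral_add_of_taylorRemainder_le
    (hF0.integrable_comp hF1 hΩ.bounded hp hG)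
    (hF0.integrable_fderiv_comp hF1 hΩ.bounded hp hG hgrad)
    (hF0.integrable_hessZ_comp hΩ.bounded hG hgrad)
    (hF0.integrable_comp hF1 hΩ.bounded hp (hG.add hgrad))
    (integrable_norm_pow_of_memLp_top hgrad 2) (integrable_norm_pow_of_memLp_top hgrad _)
    hR (hext φ hφ) (hsec φ hφ) ?_
  calc C * ∫ x in Ω, ‖grad φ x‖ ^ (⌈p⌉₊ + 3)
      ≤ C * (c₃ / 4 / C * ∫ x in Ω, ‖grad φ x‖ ^ 2) := by gcongr
    _ = c₃ / 4 * ∫ x in Ω, ‖grad φ x‖ ^ 2 := by field_simp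

theorem theorem4p3 {n N : ℕ} (Ω : Set (Vec n)) (hΩ : IsLipschitzDomain Ω)
    (p : ℝ) (hp : 1 < p) (F : Vec n → Mat N n → ℝ)
    (hF0 : HypReg Ω F) (hF1 : HypGrowth Ω p F) (hF2 : HypStrongQC Ω p F)
    (hqc : ∀ x₀ ∈ closure Ω, IsQuasiconvex (F x₀))
    (u : Vec n → Vec N) (Du : Vec n → Mat N n) (hu : MemW1Inf Ω u Du)
    (hext : ∀ φ : Vec n → Vec N, IsTestMap Ω φ →
      ∫ x in Ω, fderiv ℝ (F x) (Du x) (grad φ x) = 0)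
    (c₃ : ℝ) (hc₃ : 0 < c₃)
    (hsec : ∀ φ : Vec n → Vec N, IsTestMap Ω φ →
      c₃ * ∫ x in Ω, ‖grad φ x‖ ^ 2 ≤ ∫ x in Ω, hessZ F x (Du x) (grad φ x) (grad φ x)) :
    ∃ δ : ℝ, 0 < δ ∧ ∀ φ : Vec n → Vec N, IsTestMap Ω φ →
      bmoSeminorm Ω (grad φ) ≤ ENNReal.ofReal δ →
        ∫ x in Ω, F x (Du x) ≤ ∫ x in Ω, F x (Du x + grad φ x) :=
  theorem4p3_general hΩ (zero_lt_one.trans hp).le hF0 hF1 hu.memLp_grad hext hc₃ hsec
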